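/- Two statements are made. **(A) General principle.** Let $V$ be a real Banach space, $U\subset V$, $T:V\to\mathbb{R}^k$ a continuous linear operator, and let $\mathcal{F}:U\to\mathbb{R}\cup\{+\infty\}$ be bounded below, coercive with respect to the weak topology of $V$ (for every $M\in\mathbb{R}$ the sublevel set $\{f\in U:\mathcal{F}(f)\le M\}$ is contained in a weakly compact subset of $U$) and weakly lower semicontinuous on $U$. Assume that $\mathcal{F}$ is strictly convex along fibres of $T$: if $f\neq g$ in $U$ satisfy $Tf=Tg$, $\mathcal{F}(f)<\infty$, $\mathcal{F}(g)<\infty$ and $0<t<1$, then $tf+(1-t)g\in U$ and $\mathcal{F}(tf+(1-t)g)<t\mathcal{F}(f)+(1-t)\mathcal{F}(g)$. Put $A(b)=\{f\in U: Tf=b\}$, $D=\{Tf: f\in U,\ \mathcal{F}(f)<\infty\}$, and $T^{-1}(b)=\operatorname{argmin}_{A(b)}\mathcal{F}$ for $b\in D$. Call a Banach space $X$ that is continuously embedded in $V$ *admissible* if $T^{-1}(D)\subset X$ and $T^{-1}:D\to X$ is continuous with respect to $\|\cdot\|_X$. Call $f\in V$ an *$X$-local minimiser* if $f\in U\cap X$,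 $\mathcal{F}(f)<\infty$, and there is $\varepsilon>0$ such that $\mathcal{F}(f)\le\mathcal{F}(g)$ for all $g\in U\cap X$ with $\|g-f\|_X<\varepsilon$. Then, for any two admissible spaces $X,Y$, an element $f\in V$ is an $X$-local minimiser if and only if it is a $Y$-local minimiser. **(B) The functional on the sphere.** Let $\mathcal{P}(\mathbb{S}^2)=\{f\in L^1(\mathbb{S}^2): f\ge 0 \text{ a.e.},\ \int_{\mathbb{S}^2} f\,dp=1\}$, where $dp$ is the surface measure. For $\eta\in\mathbb{R}$ let $$\mathcal{F}(f)=\int_{\mathbb{S}^2} f(p)\ln f(p)-f(p)\ln\Big(\int_{\mathbb{S}^2}\big((p\cdot q)^2-\tfrac13\big)f(q)\,dq-\eta\Big)\,dp,\qquad f\in\mathcal{P}(\mathbb{S}^2),$$ where $-\ln$ is $+\infty$ at non-positive arguments and $0\cdot(+\infty)=0$. Let $X$ be one of the spaces $L^q(\mathbb{S}^2)$ with $q\in[1,\infty]$, $C^\alpha(\mathbb{S}^2)$ with $\alpha\in[0,1)$ (where $C^0$ is the space of continuous functions), or $W^{1,q}(\mathbb{S}^2)$ with $q\in[1,\infty)$.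 Call $f\in\mathcal{P}(\mathbb{S}^2)$ an *$X$-local minimiser* if $f\in X$, $\mathcal{F}(f)<+\infty$, and there is $\varepsilon>0$ such that $\mathcal{F}(f)\le\mathcal{F}(g)$ for all $g\in\mathcal{P}(\mathbb{S}^2)\cap X$ with $\|g-f\|_X<\varepsilon$. Then, for every $\eta\in\mathbb{R}$ and every $f$, if $f$ is a $W^{1,q}$-local minimiser for some $q\in[1,\infty)$, then $f$ is an $L^1$-local minimiser. More generally, for any two spaces $X,Y$ of the above list, $f$ is an $X$-local minimiser if and only if it is a $Y$-local minimiser. -/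

import Mathlib

open MeasureTheory
open scoped ENNReal NNReal ContDiff

noncomputable section

/-! ### Abstract framework: minimisation on the fibres of a finite-rank operator -/

namespace FibreProblem

/-- The fibre `A(b) = {f ∈ U : T f = b}`. -/
def fibre {V : Type*} [NormedAddCommGroup V] [NormedSpace ℝ V] {k : ℕ}
    (U : Set V) (T : V →L[ℝ] EuclideanSpace ℝ (Fin k)) (b : EuclideanSpace ℝ (Fin k)) : Set V :=
  {f | f ∈ U ∧ T f = b}

/-- The set `D` of all `T f`, where `f ∈ U` has finite energy. -/
def finiteDomain {V : Type*} [NormedAddCommGroup V] [NormedSpace ℝ V] {k : ℕ}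
    (U : Set V) (T : V →L[ℝ] EuclideanSpace ℝ (Fin k)) (F : V → EReal) :
    Set (EuclideanSpace ℝ (Fin k)) :=
  {b | ∃ f ∈ fibre U T b, F f < ⊤}

/-- The right inverse `b ↦ argmin_{f ∈ A(b)} F(f)` of `T`; it is only used for `b ∈ D`, and only
for problems that are admissible in the sense of `IsAdmissible`, for which the minimiser exists
and is unique. -/
def fibreArgmin {V : Type*} [NormedAddCommGroup V] [NormedSpace ℝ V] {k : ℕ}
    (U : Set V) (T : V →L[ℝ] EuclideanSpace ℝ (Fin k)) (F : V → EReal)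
    (b : EuclideanSpace ℝ (Fin k)) : V :=
  Classical.epsilon fun f => f ∈ fibre U T b ∧ ∀ g ∈ fibre U T b, F f ≤ F g

/-- The assumptions on the energy `F : U → ℝ ∪ {+∞}` (values of `F` outside `U` play no role):
lower bound, coercivity and lower semicontinuity in the weak topology of `V`, and strict convexity
along the part of each fibre of `T` on which `F` is finite. -/
structure IsAdmissible {V : Type*} [NormedAddCommGroup V] [NormedSpace ℝ V] {k : ℕ}
    (U : Set V) (T : V →L[ℝ] EuclideanSpace ℝ (Fin k)) (F : V → EReal) : Prop where
  bounded_below : ∃ m : ℝ, ∀ f ∈ U, (m : EReal) ≤ F f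
  coercive : ∀ M : ℝ, ∃ K : Set (WeakSpace ℝ V), IsCompact K ∧ K ⊆ toWeakSpace ℝ V '' U ∧
    ∀ f ∈ U, F f ≤ (M : EReal) → toWeakSpace ℝ V f ∈ K
  weakly_lsc : LowerSemicontinuousOn
    (fun x : WeakSpace ℝ V => F ((toWeakSpace ℝ V).symm x)) (toWeakSpace ℝ V '' U)
  strictly_convex : ∀ f ∈ U, ∀ g ∈ U, T f = T g → f ≠ g → F f < ⊤ → F g < ⊤ →
    ∀ t : ℝ, 0 < t → t < 1 → t • f + (1 - t) • g ∈ U ∧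
      F (t • f + (1 - t) • g) < (t : EReal) * F f + ((1 - t : ℝ) : EReal) * F g

/-- The assumptions on a normed space `X`, contained in `V` through the continuous injection `ι`:
`X` contains all the fibre minimisers, and `b ↦ argmin_{A(b)} F` is continuous from `D` to `X`. -/
def IsAdmissibleSpace {V : Type*} [NormedAddCommGroup V] [NormedSpace ℝ V] {k : ℕ}
    (U : Set V) (T : V →L[ℝ] EuclideanSpace ℝ (Fin k)) (F : V → EReal)
    {X : Type*} [NormedAddCommGroup X] [NormedSpace ℝ X] (ι : X →L[ℝ] V) : Prop :=
  Function.Injective ι ∧ ∃ S : EuclideanSpace ℝ (Fin k) → X,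
    (∀ b ∈ finiteDomain U T F, ι (S b) = fibreArgmin U T F b) ∧
      ContinuousOn S (finiteDomain U T F)

/-- `f` is an `X`-local minimiser of `F : U → ℝ ∪ {+∞}`: it lies in `U ∩ X`, has finite energy,
and minimises `F` among the elements of `U ∩ X` in some `X`-ball around it. -/
def IsLocalMinimiser {V : Type*} [NormedAddCommGroup V] [NormedSpace ℝ V]
    (U : Set V) (F : V → EReal)
    {X : Type*} [NormedAddCommGroup X] [NormedSpace ℝ X] (ι : X →L[ℝ] V) (f : V) : Prop :=
  f ∈ U ∧ F f < ⊤ ∧ ∃ x : X, ι x = f ∧ ∃ ε : ℝ, 0 < ε ∧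
    ∀ y : X, ‖y - x‖ < ε → ι y ∈ U → F f ≤ F (ι y)

end FibreProblem

/-! ### The functional on probability densities on the sphere -/

namespace SphereEnergy

/-- Euclidean three-space. -/
abbrev E3 : Type := EuclideanSpace ℝ (Fin 3)

/-- The unit sphere in `ℝ³`. -/
abbrev S2 : Type := Metric.sphere (0 : E3) 1

/-- The surface measure on the unit sphere (two-dimensional Hausdorff measure with its usual
normalisation, of total mass `4π`). -/
def surf : Measure S2 := (volume : Measure E3).toSphere

/-- The set of probability densities on the sphere. -/
def IsDensity (f : S2 → ℝ) : Prop :=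
  Integrable f surf ∧ (∀ᵐ p ∂surf, 0 ≤ f p) ∧ ∫ p, f p ∂surf = 1

/-- The function `-ln`, extended by `+∞` to non-positive arguments. -/
def negLog (t : ℝ) : EReal := if 0 < t then ((-Real.log t : ℝ) : EReal) else ⊤

/-- The potential `∫ ((p·q)² - 1/3) f(q) dq`, which equals `Q p·p` for the Q-tensor of `f`. -/
def potential (f : S2 → ℝ) (p : S2) : ℝ :=
  ∫ q, ((inner ℝ (p : E3) (q : E3)) ^ 2 - 1 / 3) * f q ∂surf

/-- The Lebesgue integral of an extended-real function, as the integral of its positive part minus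
the integral of its negative part. -/
def extIntegral (g : S2 → EReal) : EReal :=
  ((∫⁻ p, (g p).toENNReal ∂surf : ℝ≥0∞) : EReal) - ((∫⁻ p, (-g p).toENNReal ∂surf : ℝ≥0∞) : EReal)

/-- The energy `∫ f ln f - f ln (∫ ((p·q)² - 1/3) f(q) dq - η) dp`, with `0 · (+∞) = 0`. For a
probability density the negative part of the integrand has a finite integral. -/
def energy (η : ℝ) (f : S2 → ℝ) : EReal :=
  extIntegral fun p =>
    ((f p * Real.log (f p) : ℝ) : EReal) + (f p : EReal) * negLog (potential f p - η)

/-- The surface divergence on the sphere of a vector field on `ℝ³`. -/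
def surfaceDiv (Φ : E3 → E3) (p : E3) : ℝ :=
  LinearMap.trace ℝ E3 (fderiv ℝ Φ p : E3 →ₗ[ℝ] E3) - inner ℝ (fderiv ℝ Φ p p) p

/-- `G` is the weak (tangential) gradient of `u` on the sphere. The test fields are the smooth
tangential vector fields, each written as the restriction of a smooth field on `ℝ³`. -/
def IsWeakGradient (u : S2 → ℝ) (G : S2 → E3) : Prop :=
  Integrable u surf ∧ Integrable G surf ∧ (∀ᵐ p ∂surf, inner ℝ (G p) (p : E3) = 0) ∧
    ∀ Φ : E3 → E3, ContDiff ℝ ∞ Φ → (∀ p : S2, inner ℝ (Φ p) (p : E3) = 0) →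
      ∫ p, u p * surfaceDiv Φ p ∂surf = -∫ p, inner ℝ (G p) (Φ p) ∂surf

/-- The norm of `W^{1,q}`, with value `∞` on functions that are not in the space. The weak gradient
is unique up to null sets when it exists, so the infimum selects it. -/
def sobolevNorm (q : ℝ≥0∞) (u : S2 → ℝ) : ℝ≥0∞ :=
  ⨅ (G : S2 → E3) (_ : IsWeakGradient u G), eLpNorm u q surf + eLpNorm G q surf

/-- The norm of `C^α`, with value `∞` on functions that have no representative in the space. The
continuous representative is unique when it exists, so the infimum selects it. For `α = 0` this is
equivalent to the supremum norm on continuous functions. -/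
def holderNorm (α : ℝ≥0) (u : S2 → ℝ) : ℝ≥0∞ :=
  ⨅ (v : S2 → ℝ) (_ : Continuous v) (_ : v =ᵐ[surf] u), (⨆ p, ‖v p‖ₑ) + eHolderNorm α v

/-- The function spaces `L^q` (`1 ≤ q ≤ ∞`), `C^α` (`0 ≤ α < 1`), `W^{1,q}` (`1 ≤ q < ∞`). -/
inductive FunctionSpace : Type
  | lebesgue (q : ℝ≥0∞) (hq : 1 ≤ q) : FunctionSpace
  | holder (α : ℝ≥0) (hα : α < 1) : FunctionSpace
  | sobolev (q : ℝ≥0∞) (hq : 1 ≤ q) (hq_top : q < ⊤) : FunctionSpace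

/-- The norm of a function space, with value `∞` on integrable functions outside the space. -/
def FunctionSpace.eNorm : FunctionSpace → (S2 → ℝ) → ℝ≥0∞
  | .lebesgue q _, u => eLpNorm u q surf
  | .holder α _, u => holderNorm α u
  | .sobolev q _ _, u => sobolevNorm q u

/-- `f` is an `X`-local minimiser of the energy: it is a probability density in `X` with finite
energy, and minimises the energy among the probability densities in some `X`-ball around it. -/
def IsLocalMinimiser (X : FunctionSpace) (η : ℝ) (f : S2 → ℝ) : Prop :=
  IsDensity f ∧ X.eNorm f < ⊤ ∧ energy η f < ⊤ ∧ ∃ ε : ℝ≥0∞, 0 < ε ∧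
    ∀ g : S2 → ℝ, IsDensity g → X.eNorm (g - f) < ε → energy η f ≤ energy η g

end SphereEnergy

end

/-!
Both parts rest on one reduction. Let `S b` be the minimiser of the energy on the fibre
`{T f = b}`. A local minimiser `f` in any admissible norm is the minimiser of its own fibre: the
segment from `f` to `S (T f)` stays in the fibre, approaches `f` in every norm, and the energy is
strictly convex along it. Once `f = S (T f)`, continuity of `S` into the space and of `T` on it
turn local minimality of `f` into local minimality of `T f` for the function `b ↦ F (S b)` on the
finite-dimensional set `D`, a condition in which the space does not occur
(`FibreProblem.isLocalMinimiser_iff`). In the abstract part, `S b` exists by weak compactness of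
sublevel sets and weak lower semicontinuity.

On the sphere, `T f` is the Q-tensor `∫ (p ⊗ p - 1/3) f(p) dp`, and the argument of the logarithm
depends on `f` through `b = T f` only: it is `w_b(p) = ⟪b, p ⊗ p - 1/3⟫ - η`. No weak compactness
is needed, since the fibre problem is a maximum entropy problem with an explicit solution,
`S b = (w_b)₊ exp ⟪Λ, p ⊗ p - 1/3 - b⟫ / J(b, Λ)`, where `Λ` minimises the partition function
`J(b, ·)`. For `b ∈ D` this convex function is coercive, locally uniformly in `b`
(`exists_norm_le_partition`), because `b` is interior to the convex hull of the tensors with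
positive weight (`growth_pos`); it is strictly convex because a nonconstant quadratic function has
null level sets on the sphere (`surf_level_qt`). Hence `Λ` exists, is unique, and depends
continuously on `b` (`continuousOn_multiplier`). That `S b` minimises the energy on its fibre, and
is the only minimiser, is Gibbs' principle (`gibbs_principle`), a consequence of
`x ln x - x ln y ≥ x - y`.

It remains to see that `b ↦ S b` is continuous into each space of the list
(`tendsto_eNorm_fibreMin`). The densities `P₊ exp R`, with `P` and `R` quadratic, are Lipschitz
jointly in the point and in the coefficients, which settles `L^q`, and `C^α` for `α < 1` by
interpolation. Their weak gradient contains the Heaviside function of `P`; it is found by smoothing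
the positive part and integrating by parts on the sphere (`integral_surfaceDiv_eq_zero`). Since
`P` vanishes on a null set only, dominated convergence gives continuity of the gradient in `L^q`
for `q < ∞`; the jump of the gradient is why this fails in `W^{1,∞}`.
-/

noncomputable section

open Filter Topology

/-! ### Local minimisers in the abstract framework -/

namespace FibreProblem

section

variable {V : Type*} [NormedAddCommGroup V] [NormedSpace ℝ V] {k : ℕ}
  {U : Set V} {T : V →L[ℝ] EuclideanSpace ℝ (Fin k)} {F : V → EReal}

/-- The direct method on a fibre: each fibre is weakly closed, being cut out by the
continuous functionals that are the components of `T`. -/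
lemma IsAdmissible.fibreArgmin_spec (h : IsAdmissible U T F) {b : EuclideanSpace ℝ (Fin k)}
    (hb : b ∈ finiteDomain U T F) :
    fibreArgmin U T F b ∈ fibre U T b ∧ ∀ g ∈ fibre U T b, F (fibreArgmin U T F b) ≤ F g := by
  refine Classical.epsilon_spec (p := fun f => f ∈ fibre U T b ∧ ∀ g ∈ fibre U T b, F f ≤ F g) ?_
  obtain ⟨f₀, hf₀, hfin⟩ := hb
  obtain ⟨M, hM⟩ : ∃ M : ℝ, F f₀ ≤ M := ⟨(F f₀).toReal, EReal.le_coe_toReal hfin.ne⟩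
  obtain ⟨K, hK, hKU, hMK⟩ := h.coercive M
  have hcl : IsClosed {x : WeakSpace ℝ V | T ((toWeakSpace ℝ V).symm x) = b} := by
    have : {x : WeakSpace ℝ V | T ((toWeakSpace ℝ V).symm x) = b} =
        ⋂ i, {x : WeakSpace ℝ V | T ((toWeakSpace ℝ V).symm x) i = b i} := by
      ext x
      simp only [Set.mem_ofPred_eq, Set.mem_iInter]
      exact ⟨fun hx i => by rw [hx], fun hx => by ext i; exact hx i⟩
    rw [this]
    refine isClosed_iInter fun i => isClosed_eq ?_ continuous_const
    exact WeakBilin.eval_continuous (topDualPairing ℝ V).flip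
      ((EuclideanSpace.proj i : EuclideanSpace ℝ (Fin k) →L[ℝ] ℝ).comp T)
  have hK' := hK.inter_right hcl
  obtain ⟨x, hx, hmin⟩ := (h.weakly_lsc.mono (Set.inter_subset_left.trans hKU)).exists_isMinOn
    (s := K ∩ {x : WeakSpace ℝ V | T ((toWeakSpace ℝ V).symm x) = b})
    ⟨toWeakSpace ℝ V f₀, hMK f₀ hf₀.1 hM, by simpa using hf₀.2⟩ hK'
  have hle : ∀ g ∈ fibre U T b, F g ≤ M → F ((toWeakSpace ℝ V).symm x) ≤ F g := fun g hg hgM => by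
    have := hmin ⟨hMK g hg.1 hgM, show T ((toWeakSpace ℝ V).symm (toWeakSpace ℝ V g)) = b by
      simpa using hg.2⟩
    simpa using this
  refine ⟨(toWeakSpace ℝ V).symm x, ⟨?_, hx.2⟩, fun g hg => ?_⟩
  · obtain ⟨u, hu, rfl⟩ := hKU hx.1
    simpa using hu
  · rcases le_total (F g) M with hgM | hgM
    · exact hle g hg hgM
    · exact ((hle f₀ hf₀ hM).trans hM).trans hgM

/-- The characterisation that makes local minimality independent of the space: an `X`-local
minimiser is a fibre minimiser whose image under `T` is a local minimiser, in the
finite-dimensional set `D`, of the energy of the fibre minimisers. -/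
lemma isLocalMinimiser_iff (h : IsAdmissible U T F)
    {X : Type*} [NormedAddCommGroup X] [NormedSpace ℝ X] {ι : X →L[ℝ] V}
    (hX : IsAdmissibleSpace U T F ι) (f : V) :
    IsLocalMinimiser U F ι f ↔ f ∈ U ∧ F f < ⊤ ∧ f = fibreArgmin U T F (T f) ∧
      ∀ᶠ b in 𝓝[finiteDomain U T F] (T f), F f ≤ F (fibreArgmin U T F b) := by
  obtain ⟨hinj, S, hS, hScont⟩ := hX
  constructor
  · rintro ⟨hfU, hfin, x, hx, ε, hε, hmin⟩
    have hD : T f ∈ finiteDomain U T F := ⟨f, ⟨hfU, rfl⟩, hfin⟩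
    obtain ⟨⟨hsU, hsT⟩, hsmin⟩ := h.fibreArgmin_spec hD
    have hsle := hsmin f ⟨hfU, rfl⟩
    have heq : f = fibreArgmin U T F (T f) := by
      by_contra hne
      set s := fibreArgmin U T F (T f) with hs
      -- along the segment from `f` to the fibre minimiser the energy is strictly below `F f`
      have hcont : ContinuousAt (fun t : ℝ => t • S (T f) + (1 - t) • x) 0 := by fun_prop
      have hev : ∀ᶠ t : ℝ in 𝓝[>] 0, ‖(t • S (T f) + (1 - t) • x) - x‖ < ε := by
        have := (Metric.continuousAt_iff.1 hcont) ε hε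
        obtain ⟨δ, hδ, hball⟩ := this
        filter_upwards [nhdsWithin_le_nhds (Metric.ball_mem_nhds (0 : ℝ) hδ)] with t ht
        simpa [dist_eq_norm] using hball ht
      have hev1 : ∀ᶠ t : ℝ in 𝓝[>] 0, t < 1 :=
        nhdsWithin_le_nhds (gt_mem_nhds zero_lt_one)
      obtain ⟨t, ht, ht1, ht0⟩ := (hev.and (hev1.and self_mem_nhdsWithin)).exists
      obtain ⟨hU', hlt⟩ := h.strictly_convex s hsU f hfU hsT (Ne.symm hne)
        (hsle.trans_lt hfin) hfin t ht0 ht1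
      have hι : ι (t • S (T f) + (1 - t) • x) = t • s + (1 - t) • f := by
        simp [hS _ hD, hx, hs]
      have hge := hmin _ ht (by rwa [hι])
      rw [hι] at hge
      obtain ⟨m, hm⟩ := h.bounded_below
      have hfm : F f ≠ ⊥ := ((EReal.bot_lt_coe m).trans_le (hm f hfU)).ne'
      have hsm : F s ≠ ⊥ := ((EReal.bot_lt_coe m).trans_le (hm s hsU)).ne'
      lift F f to ℝ using ⟨hfin.ne, hfm⟩ with A hA
      lift F s to ℝ using ⟨(hsle.trans_lt hfin).ne, hsm⟩ with B hB
      have h1 := hge.trans_lt hlt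
      rw [← EReal.coe_mul, ← EReal.coe_mul, ← EReal.coe_add, EReal.coe_lt_coe_iff] at h1
      rw [EReal.coe_le_coe_iff] at hsle
      have ht0' : 0 < t := ht0
      nlinarith
    refine ⟨hfU, hfin, heq, ?_⟩
    have hxS : S (T f) = x := hinj (by rw [hS _ hD, hx, ← heq])
    have hc := hScont (T f) hD
    rw [ContinuousWithinAt, hxS] at hc
    filter_upwards [hc (Metric.ball_mem_nhds x hε), self_mem_nhdsWithin] with b hb hbD
    have := hmin (S b) (by simpa [dist_eq_norm] using hb)
      (by rw [hS b hbD]; exact (h.fibreArgmin_spec hbD).1.1)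
    rwa [hS b hbD] at this
  · rintro ⟨hfU, hfin, heq, hev⟩
    have hD : T f ∈ finiteDomain U T F := ⟨f, ⟨hfU, rfl⟩, hfin⟩
    refine ⟨hfU, hfin, S (T f), by rw [hS _ hD, ← heq], ?_⟩
    have hc : Tendsto (fun y : X => T (ι y)) (𝓝 (S (T f))) (𝓝 (T f)) := by
      have : Continuous fun y : X => T (ι y) := by fun_prop
      have := this.tendsto (S (T f))
      rwa [hS _ hD, ← heq] at this
    obtain ⟨ε, hε, hball⟩ := Metric.eventually_nhds_iff.1
      (hc.eventually (eventually_nhdsWithin_iff.1 hev))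
    refine ⟨ε, hε, fun y hy hyU => ?_⟩
    rcases eq_top_or_lt_top (F (ι y)) with htop | htop
    · rw [htop]; exact le_top
    · have hyD : T (ι y) ∈ finiteDomain U T F := ⟨ι y, ⟨hyU, rfl⟩, htop⟩
      exact (hball (by simpa [dist_eq_norm] using hy) hyD).trans
        ((h.fibreArgmin_spec hyD).2 _ ⟨hyU, rfl⟩)

end

end FibreProblem

/-! ### Second moments on the sphere -/

namespace SphereEnergy

instance : IsFiniteMeasure surf := by unfold surf; infer_instance

/-- The Euclidean space of real `3 × 3` matrices. -/
abbrev E9 : Type := EuclideanSpace ℝ (Fin 3 × Fin 3)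

/-- The trace-free part `x ⊗ x - 1/3` of the second moment of a unit vector `x`, as a function on
all of `ℝ³`. -/
def qTensor (x : E3) : E9 :=
  WithLp.toLp 2 fun ij => x ij.1 * x ij.2 - if ij.1 = ij.2 then 1 / 3 else 0

lemma contDiff_qTensor : ContDiff ℝ ∞ qTensor := by
  rw [contDiff_euclidean]
  intro ij
  simp only [qTensor]
  have h (i : Fin 3) : ContDiff ℝ ∞ fun x : E3 => x i :=
    (EuclideanSpace.proj i : E3 →L[ℝ] ℝ).contDiff
  exact ((h _).mul (h _)).sub contDiff_const

lemma sum_sq_coord (p : S2) :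
    (p : E3) 0 ^ 2 + (p : E3) 1 ^ 2 + (p : E3) 2 ^ 2 = 1 := by
  have h : ‖(p : E3)‖ ^ 2 = 1 := by simp
  rw [EuclideanSpace.norm_sq_eq] at h
  simpa [Fin.sum_univ_three] using h

lemma inner_qTensor (p q : S2) :
    inner ℝ (qTensor p) (qTensor q) = inner ℝ (p : E3) (q : E3) ^ 2 - 1 / 3 := by
  have hp := sum_sq_coord p
  have hq := sum_sq_coord q
  simp only [qTensor, PiLp.inner_apply, Fintype.sum_prod_type, Fin.sum_univ_three,
    RCLike.inner_apply, conj_trivial]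
  simp
  linear_combination (-(1 / 3 : ℝ)) * hp - (1 / 3 : ℝ) * hq

/-- The space of trace-free symmetric matrices, described as the span of the tensors
`p ⊗ p - 1/3`. -/
def QSpace : Submodule ℝ E9 := Submodule.span ℝ (Set.range fun p : S2 => qTensor p)

/-- The tensor `p ⊗ p - 1/3` as an element of `QSpace`. -/
def qt (p : S2) : QSpace := ⟨qTensor p, Submodule.subset_span ⟨p, rfl⟩⟩

@[simp] lemma coe_qt (p : S2) : (qt p : E9) = qTensor p := rfl

lemma continuous_qt : Continuous qt :=
  (contDiff_qTensor.continuous.comp continuous_subtype_val).subtype_mk _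

lemma norm_qt_le (p : S2) : ‖qt p‖ ≤ 1 := by
  have h : ‖qt p‖ ^ 2 = 2 / 3 := by
    rw [← real_inner_self_eq_norm_sq, Submodule.coe_inner, coe_qt, inner_qTensor]
    simp; norm_num
  nlinarith [norm_nonneg (qt p)]

/-- The zero set on the sphere of a homogeneous quadratic polynomial is a null set: on each line
in a direction in which the polynomial does not vanish it has at most two zeros. -/
lemma surf_zeros_quadratic {h : E3 → ℝ} (hc : Continuous h)
    (hom : ∀ (r : ℝ) (x : E3), h (r • x) = r ^ 2 * h x) (v : E3) (hv : h v ≠ 0)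
    (hline : ∀ x, ∃ B, ∀ t : ℝ, h (x + t • v) = h x + t * B + t ^ 2 * h v) :
    surf {p : S2 | h p = 0} = 0 := by
  have hcl : IsClosed {x : E3 | h x = 0} := isClosed_eq hc continuous_const
  have hvol : (volume : Measure E3) {x | h x = 0} = 0 := by
    have := ae_mem_of_ae_add_linearMap_mem (LinearMap.toSpanSingleton ℝ E3 v)
      (volume : Measure ℝ) (volume : Measure E3) (s := {x | h x = 0}ᶜ)
      hcl.measurableSet.compl (fun x => by
        obtain ⟨B, hB⟩ := hline x
        have hp : (Polynomial.C (h v) * Polynomial.X ^ 2 + Polynomial.C B * Polynomial.X +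
            Polynomial.C (h x)) ≠ 0 := by
          intro h0
          have := congrArg (fun P => Polynomial.coeff P 2) h0
          simp at this
          exact hv this
        have hfin := Polynomial.finite_setOfPred_isRoot hp
        have h0 := hfin.measure_zero volume
        rw [ae_iff]
        refine measure_mono_null (fun t ht => ?_) h0
        simp only [Set.mem_compl_iff, Set.mem_ofPred_eq, not_not, LinearMap.toSpanSingleton_apply]
          at ht
        rw [hB t] at ht
        simp only [Set.mem_ofPred_eq, Polynomial.IsRoot, Polynomial.eval_add, Polynomial.eval_mul,
          Polynomial.eval_C, Polynomial.eval_pow, Polynomial.eval_X]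
        linarith)
    rw [ae_iff] at this
    simpa using this
  have hm : MeasurableSet {p : S2 | h p = 0} :=
    (hcl.preimage continuous_subtype_val).measurableSet
  rw [surf, Measure.toSphere_apply' _ hm]
  refine mul_eq_zero_of_right _ (measure_mono_null ?_ hvol)
  rintro _ ⟨r, -, _, ⟨p, hp, rfl⟩, rfl⟩
  simpa [hom] using Or.inr hp

/-- Nondegeneracy, the source of strict convexity of the dual problem: a nonconstant quadratic
function on the sphere has null level sets. -/
lemma surf_level_qt {ξ : QSpace} (hξ : ξ ≠ 0) (c : ℝ) :
    surf {p : S2 | inner ℝ ξ (qt p) = c} = 0 := by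
  let h : E3 → ℝ := fun x => (∑ i, ∑ j, (ξ : E9) (i, j) * (x i * x j)) -
    ((∑ i, (ξ : E9) (i, i)) / 3 + c) * ∑ i, x i ^ 2
  have hS (p : S2) : h p = inner ℝ ξ (qt p) - c := by
    have hp := sum_sq_coord p
    simp only [h, Submodule.coe_inner, coe_qt, qTensor, PiLp.inner_apply, Fintype.sum_prod_type,
      Fin.sum_univ_three, RCLike.inner_apply, conj_trivial]
    simp
    linear_combination
      (-(((ξ : E9) (0, 0) + (ξ : E9) (1, 1) + (ξ : E9) (2, 2)) / 3 + c)) * hp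
  have hset : {p : S2 | inner ℝ ξ (qt p) = c} = {p : S2 | h p = 0} := by
    ext p; simp [hS, sub_eq_zero]
  rw [hset]
  have hhom (r : ℝ) (x : E3) : h (r • x) = r ^ 2 * h x := by
    simp [h, Fin.sum_univ_three]; ring
  have hcont : Continuous h := by
    have (i : Fin 3) : Continuous fun x : E3 => x i :=
      (EuclideanSpace.proj i : E3 →L[ℝ] ℝ).continuous
    simp only [h]; fun_prop
  by_cases hall : ∀ p : S2, h p = 0
  · -- the constant `c` vanishes by summing over an orthonormal basis, and then `ξ ⊥ QSpace`
    exfalso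
    have hb (i : Fin 3) : inner ℝ (ξ : E9)
        (qTensor (EuclideanSpace.single i (1 : ℝ))) = c := by
      have := hall ⟨EuclideanSpace.single i 1, by simp⟩
      rw [hS, sub_eq_zero] at this
      exact this
    have h0 := hb 0
    have h1 := hb 1
    have h2 := hb 2
    simp only [qTensor, PiLp.inner_apply, Fintype.sum_prod_type, Fin.sum_univ_three,
      RCLike.inner_apply, conj_trivial] at h0 h1 h2
    simp at h0 h1 h2
    have hc : c = 0 := by linarith
    have hperp : ∀ w ∈ QSpace, inner ℝ (ξ : E9) w = 0 := by
      intro w hw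
      refine Submodule.span_induction ?_ (by simp) ?_ ?_ hw
      · rintro _ ⟨p, rfl⟩
        have := hall p
        rw [hS, hc, sub_zero] at this
        exact this
      · intro x y _ _ hx hy; rw [inner_add_right, hx, hy, add_zero]
      · intro a x _ hx; rw [inner_smul_right, hx, mul_zero]
    have := hperp ξ ξ.2
    rw [inner_self_eq_zero] at this
    exact hξ (Subtype.ext this)
  · push Not at hall
    obtain ⟨v, hv⟩ := hall
    refine surf_zeros_quadratic hcont hhom v hv fun x =>
      ⟨h (x + (v : E3)) - h x - h v, fun t => ?_⟩
    simp [h, Fin.sum_univ_three]; ring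

lemma integrable_smul_qt {f : S2 → ℝ} (hf : Integrable f surf) :
    Integrable (fun p => f p • qt p) surf :=
  hf.smul_bdd 1 continuous_qt.aestronglyMeasurable (ae_of_all _ norm_qt_le)

/-- The trace-free second moment (the Q-tensor) of `f`. -/
def moment (f : S2 → ℝ) : QSpace := ∫ p, f p • qt p ∂surf

lemma integral_mul_inner_qt {f : S2 → ℝ} (hf : Integrable f surf) (ξ : QSpace) :
    ∫ p, f p * inner ℝ ξ (qt p) ∂surf = inner ℝ ξ (moment f) := by
  rw [moment, ← integral_inner (integrable_smul_qt hf)]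
  simp [inner_smul_right]

lemma integrable_mul_inner_qt {f : S2 → ℝ} (hf : Integrable f surf) (ξ : QSpace) :
    Integrable (fun p => f p * inner ℝ ξ (qt p)) surf := by
  simpa [inner_smul_right] using (integrable_smul_qt hf).const_inner (𝕜 := ℝ) ξ

lemma potential_eq {f : S2 → ℝ} (hf : Integrable f surf) (p : S2) :
    potential f p = inner ℝ (moment f) (qt p) := by
  rw [real_inner_comm, ← integral_mul_inner_qt hf, potential]
  refine integral_congr_ae (ae_of_all _ fun q => ?_)
  simp only [Submodule.coe_inner, coe_qt, inner_qTensor]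
  ring

lemma enorm_moment_sub_le {f g : S2 → ℝ} (hf : Integrable f surf) (hg : Integrable g surf) :
    ‖moment g - moment f‖ₑ ≤ eLpNorm (g - f) 1 surf := by
  rw [moment, moment, ← integral_sub (integrable_smul_qt hg) (integrable_smul_qt hf),
    eLpNorm_one_eq_lintegral_enorm]
  refine (enorm_integral_le_lintegral_enorm _).trans (lintegral_mono fun p => ?_)
  rw [← sub_smul, enorm_smul]
  refine mul_le_of_le_one_right' ?_
  simpa [enorm_le_iff_norm_le] using
    (enorm_le_iff_norm_le (y := (1 : ℝ))).2 (by simpa using norm_qt_le p)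

end SphereEnergy

/-! ### The energy of a density as a Lebesgue integral -/

namespace SphereEnergy

/-- The argument of the logarithm in the energy of a density with Q-tensor `b`. -/
def weight (η : ℝ) (b : QSpace) (p : S2) : ℝ := inner ℝ b (qt p) - η

lemma continuous_weight_right (η : ℝ) (b : QSpace) : Continuous (weight η b) := by
  have := continuous_qt
  unfold weight; fun_prop

/-- A continuous function on the sphere is integrable. -/
lemma integrable_of_continuous {F : Type*} [NormedAddCommGroup F] {g : S2 → F}
    (hg : Continuous g) : Integrable g surf :=
  hg.integrable_of_hasCompactSupport (HasCompactSupport.of_compactSpace g)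

/-- The real-valued integrand of the energy. It has the intended meaning where `f` vanishes and
where the weight is positive. -/
def energyDensity (η : ℝ) (b : QSpace) (f : S2 → ℝ) (p : S2) : ℝ :=
  f p * Real.log (f p) - f p * Real.log (weight η b p)

/-- The pointwise inequality behind Gibbs' variational principle. -/
lemma sub_le_mul_log_sub {x y : ℝ} (hx : 0 ≤ x) (hy : 0 < y) :
    x - y ≤ x * Real.log x - x * Real.log y := by
  rcases hx.eq_or_lt with rfl | hx
  · simp [hy.le]
  · have h := Real.log_le_sub_one_of_pos (div_pos hy hx)
    rw [Real.log_div hy.ne' hx.ne'] at h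
    have h2 := mul_le_mul_of_nonneg_left h hx.le
    have h3 : x * (y / x - 1) = y - x := by field_simp
    linarith

/-- The equality case of `sub_le_mul_log_sub`. -/
lemma eq_of_mul_log_sub_eq {x y : ℝ} (hx : 0 ≤ x) (hy : 0 < y)
    (h : x * Real.log x - x * Real.log y = x - y) : x = y := by
  rcases hx.eq_or_lt with rfl | hx
  · simp at h; linarith
  · by_contra hne
    have h1 := Real.log_lt_sub_one_of_pos (div_pos hy hx)
      (fun h => hne ((div_eq_one_iff_eq hx.ne').1 h).symm)
    rw [Real.log_div hy.ne' hx.ne'] at h1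
    have h2 := mul_lt_mul_of_pos_left h1 hx
    have h3 : x * (y / x - 1) = y - x := by field_simp
    linarith

/-- The energy density is bounded below by a continuous function that depends on the Q-tensor
only. -/
lemma neg_abs_weight_le_energyDensity {η : ℝ} {b : QSpace} {f : S2 → ℝ} {p : S2} (hf : 0 ≤ f p)
    (hw : f p = 0 ∨ 0 < weight η b p) : -|weight η b p| ≤ energyDensity η b f p := by
  rcases hw with h | h
  · simp [energyDensity, h]
  · have := sub_le_mul_log_sub hf h
    rw [abs_of_pos h, energyDensity]
    linarith

lemma aestronglyMeasurable_energyDensity (η : ℝ) (b : QSpace) {f : S2 → ℝ}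
    (hf : AEStronglyMeasurable f surf) : AEStronglyMeasurable (energyDensity η b f) surf := by
  have h1 := hf.aemeasurable
  have h2 : Measurable (weight η b) := (continuous_weight_right η b).measurable
  unfold energyDensity
  exact ((h1.mul (Real.measurable_log.comp_aemeasurable h1)).sub
    (h1.mul (Real.measurable_log.comp h2).aemeasurable)).aestronglyMeasurable

/-- The extended-real integrand of the energy. -/
lemma energy_integrand_eq {η : ℝ} {f : S2 → ℝ} (hf : Integrable f surf) {p : S2} (hp : 0 ≤ f p) :
    ((f p * Real.log (f p) : ℝ) : EReal) + (f p : EReal) * negLog (potential f p - η) =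
      if 0 < f p ∧ weight η (moment f) p ≤ 0 then ⊤
      else (energyDensity η (moment f) f p : EReal) := by
  rw [potential_eq hf, ← weight]
  rcases hp.eq_or_lt with h | h
  · simp [← h, energyDensity]
  · rcases le_or_gt (weight η (moment f) p) 0 with hw | hw
    · rw [if_pos ⟨h, hw⟩, negLog, if_neg hw.not_gt, EReal.coe_mul_top_of_pos h,
        EReal.add_top_of_ne_bot (EReal.coe_ne_bot _)]
    · rw [if_neg (fun hh => hh.2.not_gt hw), negLog, if_pos hw, energyDensity, ← EReal.coe_mul,
        ← EReal.coe_add]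
      congr 1; ring

lemma lintegral_ofReal_ne_top {e : S2 → ℝ} (he : Integrable e surf) :
    ∫⁻ p, ENNReal.ofReal (e p) ∂surf ≠ ⊤ :=
  ((lintegral_ofReal_le_lintegral_enorm e).trans_lt he.2).ne

lemma extIntegral_coe {I : S2 → EReal} {e : S2 → ℝ} (h : ∀ᵐ p ∂surf, I p = e p)
    (he : Integrable e surf) : extIntegral I = ((∫ p, e p ∂surf : ℝ) : EReal) := by
  have h1 : ∫⁻ p, (I p).toENNReal ∂surf = ∫⁻ p, ENNReal.ofReal (e p) ∂surf :=
    lintegral_congr_ae (h.mono fun p hp => by simp [hp])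
  have h2 : ∫⁻ p, (-I p).toENNReal ∂surf = ∫⁻ p, ENNReal.ofReal (-e p) ∂surf :=
    lintegral_congr_ae (h.mono fun p hp => by simp [hp, ← EReal.coe_neg])
  have t1 : ∫⁻ p, ENNReal.ofReal (e p) ∂surf ≠ ⊤ := (lintegral_ofReal_ne_top he)
  have t2 : ∫⁻ p, ENNReal.ofReal (-e p) ∂surf ≠ ⊤ := (lintegral_ofReal_ne_top he.neg)
  rw [extIntegral, h1, h2, integral_eq_lintegral_pos_part_sub_lintegral_neg_part he,
    EReal.coe_sub, EReal.coe_ennreal_toReal t1, EReal.coe_ennreal_toReal t2]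

lemma energy_eq_integral {η : ℝ} {f : S2 → ℝ} (hf : IsDensity f)
    (hw : ∀ᵐ p ∂surf, f p = 0 ∨ 0 < weight η (moment f) p)
    (he : Integrable (energyDensity η (moment f) f) surf) :
    energy η f = ((∫ p, energyDensity η (moment f) f p ∂surf : ℝ) : EReal) := by
  refine extIntegral_coe ?_ he
  filter_upwards [hf.2.1, hw] with p hp hwp
  rw [energy_integrand_eq hf.1 hp, if_neg]
  rintro ⟨h1, h2⟩
  rcases hwp with h | h <;> linarith

/-- A density of finite energy lives where the weight is positive, and its energy density is
integrable. -/
lemma of_energy_lt_top {η : ℝ} {f : S2 → ℝ} (hf : IsDensity f) (hfin : energy η f < ⊤) :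
    (∀ᵐ p ∂surf, f p = 0 ∨ 0 < weight η (moment f) p) ∧
      Integrable (energyDensity η (moment f) f) surf := by
  set b := moment f with hb
  set I : S2 → EReal := fun p =>
    ((f p * Real.log (f p) : ℝ) : EReal) + (f p : EReal) * negLog (potential f p - η) with hI
  let Ψ : ℝ × ℝ → ℝ≥0∞ := fun z => if 0 < z.1 ∧ z.2 ≤ 0 then ⊤
    else ENNReal.ofReal (z.1 * Real.log z.1 - z.1 * Real.log z.2)
  have hΨ : Measurable Ψ := by
    refine Measurable.ite ?_ measurable_const (by fun_prop)
    exact (measurableSet_lt measurable_const measurable_fst).inter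
      (measurableSet_le measurable_snd measurable_const)
  have hIΨ : ∀ᵐ p ∂surf, (I p).toENNReal = Ψ (f p, weight η b p) := by
    filter_upwards [hf.2.1] with p hp
    simp only [hI, energy_integrand_eq hf.1 hp, Ψ, ← hb]
    split_ifs
    · simp
    · rw [EReal.real_coe_toENNReal]; rfl
  have hmeas : AEMeasurable (fun p => Ψ (f p, weight η b p)) surf :=
    hΨ.comp_aemeasurable (hf.1.aestronglyMeasurable.aemeasurable.prodMk
      (continuous_weight_right η b).measurable.aemeasurable)
  have hneg : ∫⁻ p, (-I p).toENNReal ∂surf ≠ ⊤ := by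
    refine ne_top_of_le_ne_top
      (lintegral_ofReal_ne_top (integrable_of_continuous (continuous_weight_right η b)).abs)
      (lintegral_mono_ae ?_)
    filter_upwards [hf.2.1] with p hp
    simp only [hI, energy_integrand_eq hf.1 hp, ← hb]
    split_ifs with h
    · simp
    · rw [← EReal.coe_neg, EReal.real_coe_toENNReal]
      refine ENNReal.ofReal_le_ofReal ?_
      have := neg_abs_weight_le_energyDensity (η := η) (b := b) hp (by
        rcases hp.eq_or_lt with h0 | h0
        · exact Or.inl h0.symm
        · exact Or.inr (not_le.1 fun hw => h ⟨h0, hw⟩))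
      linarith
  have hpos : ∫⁻ p, Ψ (f p, weight η b p) ∂surf ≠ ⊤ := by
    rw [← lintegral_congr_ae hIΨ]
    intro htop
    have : energy η f = ⊤ := by
      rw [energy, extIntegral]
      change ((∫⁻ p, (I p).toENNReal ∂surf : ℝ≥0∞) : EReal)
        - ((∫⁻ p, (-I p).toENNReal ∂surf : ℝ≥0∞) : EReal) = ⊤
      rw [htop, ← EReal.coe_ennreal_toReal hneg, EReal.coe_ennreal_top, EReal.top_sub_coe]
    exact hfin.ne this
  have hw : ∀ᵐ p ∂surf, f p = 0 ∨ 0 < weight η b p := by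
    filter_upwards [hf.2.1, ae_lt_top' hmeas hpos] with p hp hlt
    by_contra hcon
    push Not at hcon
    have : 0 < f p ∧ weight η b p ≤ 0 := ⟨lt_of_le_of_ne hp (Ne.symm hcon.1), hcon.2⟩
    simp [Ψ, this] at hlt
  refine ⟨hw, aestronglyMeasurable_energyDensity η b hf.1.aestronglyMeasurable, ?_⟩
  have hdom : ∀ᵐ p ∂surf, ‖energyDensity η b f p‖ₑ ≤
      Ψ (f p, weight η b p) + ENNReal.ofReal |weight η b p| := by
    filter_upwards [hf.2.1, hw] with p hp hwp
    have h1 := neg_abs_weight_le_energyDensity (η := η) (b := b) hp hwp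
    have h2 : Ψ (f p, weight η b p) = ENNReal.ofReal (energyDensity η b f p) := by
      simp only [Ψ]
      rw [if_neg]
      · rfl
      · rintro ⟨h3, h4⟩
        rcases hwp with h | h <;> linarith
    rw [h2, Real.enorm_eq_ofReal_abs]
    rcases le_total 0 (energyDensity η b f p) with h | h
    · rw [abs_of_nonneg h]; exact le_self_add
    · rw [abs_of_nonpos h]
      exact le_add_left (ENNReal.ofReal_le_ofReal (by linarith))
  refine (lintegral_mono_ae hdom).trans_lt ?_
  rw [lintegral_add_right' _ ((continuous_weight_right η b).abs.measurable.ennreal_ofReal.aemeasurable)]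
  exact ENNReal.add_lt_top.2 ⟨hpos.lt_top,
    (lintegral_ofReal_ne_top (integrable_of_continuous (continuous_weight_right η b)).abs).lt_top⟩

end SphereEnergy

/-! ### The dual problem and the fibre minimisers -/

namespace SphereEnergy

/-- The Gibbs density with weight `(⟪b, p ⊗ p - 1/3⟫ - η)₊` and multiplier `Λ`, up to
normalisation. -/
def gibbsWeight (η : ℝ) (b Λ : QSpace) (p : S2) : ℝ :=
  max (weight η b p) 0 * Real.exp (inner ℝ Λ (qt p - b))

/-- The partition function of the Gibbs densities; on the fibre over `b` its logarithm is, up to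
sign, the dual functional of the energy. -/
def partition (η : ℝ) (b Λ : QSpace) : ℝ := ∫ p, gibbsWeight η b Λ p ∂surf

/-- The set `D` of the Q-tensors of the densities of finite energy. -/
def feasible (η : ℝ) : Set QSpace := {b | ∃ g, IsDensity g ∧ energy η g < ⊤ ∧ moment g = b}

lemma continuous_integral_surf {X : Type*} [TopologicalSpace X] [FirstCountableTopology X]
    [LocallyCompactSpace X] {f : X → S2 → ℝ} (hf : Continuous (Function.uncurry f)) :
    Continuous fun x => ∫ p, f x p ∂surf := by
  simpa using continuous_parametric_integral_of_continuous (μ := surf) hf isCompact_univ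

lemma gibbsWeight_nonneg (η : ℝ) (b Λ : QSpace) (p : S2) : 0 ≤ gibbsWeight η b Λ p :=
  mul_nonneg (le_max_right _ _) (Real.exp_pos _).le

lemma continuous_gibbsWeight_uncurry (η : ℝ) :
    Continuous fun z : (QSpace × QSpace) × S2 => gibbsWeight η z.1.1 z.1.2 z.2 := by
  have h1 := continuous_qt
  have h2 : Continuous fun z : (QSpace × QSpace) × S2 => weight η z.1.1 z.2 := by
    unfold weight; fun_prop
  unfold gibbsWeight; fun_prop

lemma continuous_gibbsWeight (η : ℝ) (b Λ : QSpace) : Continuous (gibbsWeight η b Λ) := by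
  have h1 := continuous_qt
  have h2 := continuous_weight_right η b
  unfold gibbsWeight; fun_prop

lemma continuous_partition (η : ℝ) : Continuous fun z : QSpace × QSpace => partition η z.1 z.2 :=
  continuous_integral_surf (f := fun (z : QSpace × QSpace) p => gibbsWeight η z.1 z.2 p)
    (continuous_gibbsWeight_uncurry η)

/-- Since a density of finite energy lives where the weight is positive, a property that holds almost
everywhere where the weight is positive holds at a point where the density is positive. -/
lemma IsDensity.exists_of_ae {η : ℝ} {g : S2 → ℝ} (hg : IsDensity g) (hfin : energy η g < ⊤)
    {P : S2 → Prop} (hP : ∀ᵐ p ∂surf, 0 < weight η (moment g) p → P p) :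
    ∃ p, 0 < weight η (moment g) p ∧ 0 < g p ∧ P p := by
  by_contra hcon
  push Not at hcon
  have h0 : ∀ᵐ p ∂surf, g p = 0 := by
    filter_upwards [hg.2.1, (of_energy_lt_top hg hfin).1, hP] with p h1 h2 h3
    rcases h2 with h2 | h2
    · exact h2
    · by_contra hne
      exact hcon p h2 (lt_of_le_of_ne h1 (Ne.symm hne)) (h3 h2)
  have := hg.2.2
  rw [integral_congr_ae h0] at this
  simp at this

lemma partition_pos {η : ℝ} {b : QSpace} (hb : b ∈ feasible η) (Λ : QSpace) :
    0 < partition η b Λ := by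
  obtain ⟨g, hg, hfin, rfl⟩ := hb
  refine lt_of_le_of_ne (integral_nonneg (gibbsWeight_nonneg η _ Λ)) fun h0 => ?_
  have h1 := (integral_eq_zero_iff_of_nonneg (gibbsWeight_nonneg η (moment g) Λ)
    (integrable_of_continuous (continuous_gibbsWeight η _ Λ))).1 h0.symm
  obtain ⟨p, hp, -, h⟩ := hg.exists_of_ae hfin (P := fun _ => False) (by
    filter_upwards [h1] with p hp hw
    rw [gibbsWeight, max_eq_left hw.le] at hp
    exact (mul_pos hw (Real.exp_pos _)).ne' hp)
  exact h

/-- `real_inner_smul_left`, stated for the scalar action of `QSpace` as a submodule so that it can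
be used for rewriting. -/
lemma inner_smul_left_qSpace (t : ℝ) (ξ w : QSpace) :
    inner ℝ (t • ξ) w = t * inner ℝ ξ w :=
  real_inner_smul_left ξ w t

/-- A lower bound for the growth of the partition function in the direction `ξ`. -/
def growth (η : ℝ) (b ξ : QSpace) : ℝ :=
  ∫ p, max (weight η b p) 0 * max (inner ℝ ξ (qt p - b)) 0 ∂surf

lemma continuous_growth (η : ℝ) : Continuous fun z : QSpace × QSpace => growth η z.1 z.2 := by
  refine continuous_integral_surf (f := fun (z : QSpace × QSpace) p =>
    max (weight η z.1 p) 0 * max (inner ℝ z.2 (qt p - z.1)) 0) ?_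
  have h1 := continuous_qt
  have h2 : Continuous fun z : (QSpace × QSpace) × S2 => weight η z.1.1 z.2 := by
    unfold weight; fun_prop
  unfold Function.uncurry; fun_prop

lemma mul_growth_le_partition (η : ℝ) (b ξ : QSpace) (t : ℝ) :
    t * growth η b ξ ≤ partition η b (t • ξ) := by
  have h1 := continuous_qt
  have h2 := continuous_weight_right η b
  rw [growth, partition, ← integral_const_mul]
  refine integral_mono (integrable_of_continuous (by fun_prop))
    (integrable_of_continuous (continuous_gibbsWeight η b _)) fun p => ?_
  have h3 : t * max (inner ℝ ξ (qt p - b)) 0 ≤ Real.exp (inner ℝ (t • ξ) (qt p - b)) := by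
    rw [inner_smul_left_qSpace]
    rcases le_total (inner ℝ ξ (qt p - b)) 0 with h | h
    · rw [max_eq_right h, mul_zero]; exact (Real.exp_pos _).le
    · rw [max_eq_left h]
      linarith [Real.add_one_le_exp (t * inner ℝ ξ (qt p - b))]
  calc t * (max (weight η b p) 0 * max (inner ℝ ξ (qt p - b)) 0)
      = max (weight η b p) 0 * (t * max (inner ℝ ξ (qt p - b)) 0) := by ring
    _ ≤ _ := mul_le_mul_of_nonneg_left h3 (le_max_right _ _)

/-- The Q-tensor of a density of finite energy is interior to the convex hull of the tensors
`p ⊗ p - 1/3` with positive weight: no half-space bounded by a hyperplane through it contains all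
of them. -/
lemma growth_pos {η : ℝ} {b : QSpace} (hb : b ∈ feasible η) {ξ : QSpace} (hξ : ξ ≠ 0) :
    0 < growth η b ξ := by
  obtain ⟨g, hg, hfin, rfl⟩ := hb
  have hq := continuous_qt
  have hwc := continuous_weight_right η (moment g)
  have hnn : 0 ≤ fun p => max (weight η (moment g) p) 0 *
      max (inner ℝ ξ (qt p - moment g)) 0 :=
    fun p => mul_nonneg (le_max_right _ _) (le_max_right _ _)
  refine lt_of_le_of_ne (integral_nonneg hnn) fun h0 => ?_
  have h1 := (integral_eq_zero_iff_of_nonneg hnn (integrable_of_continuous (by fun_prop))).1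
    h0.symm
  have hle : ∀ᵐ p ∂surf, 0 < weight η (moment g) p → inner ℝ ξ (qt p - moment g) ≤ 0 := by
    filter_upwards [h1] with p hp hw
    by_contra hlt
    rw [not_le] at hlt
    rw [max_eq_left hw.le, max_eq_left hlt.le] at hp
    exact (mul_pos hw hlt).ne' hp
  have hint : Integrable (fun p => g p * inner ℝ ξ (qt p) - g p * inner ℝ ξ (moment g)) surf :=
    (integrable_mul_inner_qt hg.1 ξ).sub (hg.1.mul_const _)
  have hzero : ∫ p, -(g p * inner ℝ ξ (qt p) - g p * inner ℝ ξ (moment g)) ∂surf = 0 := by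
    rw [integral_neg, integral_sub (integrable_mul_inner_qt hg.1 ξ) (hg.1.mul_const _),
      integral_mul_inner_qt hg.1, integral_mul_const, hg.2.2]
    ring
  have hae : ∀ᵐ p ∂surf, g p = 0 ∨ inner ℝ ξ (qt p - moment g) = 0 := by
    have hnn' : ∀ᵐ p ∂surf, 0 ≤ -(g p * inner ℝ ξ (qt p) - g p * inner ℝ ξ (moment g)) := by
      filter_upwards [hle, hg.2.1, (of_energy_lt_top hg hfin).1] with p h2 h3 h4
      rw [← mul_sub, ← inner_sub_right]
      rcases h4 with h4 | h4
      · simp [h4]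
      · nlinarith [h2 h4]
    filter_upwards [(integral_eq_zero_iff_of_nonneg_ae hnn' hint.neg).1 hzero] with p hp
    rw [Pi.zero_apply, neg_eq_zero, ← mul_sub, ← inner_sub_right, mul_eq_zero] at hp
    exact hp
  have hne : ∀ᵐ p ∂surf, inner ℝ ξ (qt p) ≠ inner ℝ ξ (moment g) := by
    rw [ae_iff]
    simpa using surf_level_qt hξ (inner ℝ ξ (moment g))
  obtain ⟨p, -, hp, hp1, hp2⟩ := hg.exists_of_ae hfin
    (P := fun p => (g p = 0 ∨ inner ℝ ξ (qt p - moment g) = 0) ∧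
      inner ℝ ξ (qt p) ≠ inner ℝ ξ (moment g))
    (by filter_upwards [hae, hne] with p h2 h3 _ using ⟨h2, h3⟩)
  rcases hp1 with h | h
  · exact hp.ne' h
  · rw [inner_sub_right, sub_eq_zero] at h
    exact hp2 h

/-- Coercivity of the partition function, locally uniformly in the Q-tensor. -/
lemma exists_norm_le_partition {η : ℝ} {b₀ : QSpace} (hb : b₀ ∈ feasible η) :
    ∃ c > 0, ∀ᶠ b in 𝓝 b₀, ∀ Λ, c * ‖Λ‖ ≤ partition η b Λ := by
  have hK : IsCompact (Metric.sphere (0 : QSpace) 1) := isCompact_sphere _ _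
  have hcont : Continuous (growth η b₀) := (continuous_growth η).comp (Continuous.prodMk_right b₀)
  obtain ⟨c, hc, hcle⟩ := hK.exists_forall_le' hcont.continuousOn (a := 0) fun ξ hξ =>
    growth_pos hb (by rintro rfl; simp at hξ)
  refine ⟨c / 2, half_pos hc, ?_⟩
  have := hK.eventually_forall_of_forall_eventually (x₀ := b₀)
    (P := fun b ξ => c / 2 < growth η b ξ) fun ξ hξ =>
      (continuous_growth η).continuousAt.eventually (lt_mem_nhds (by
        show c / 2 < growth η b₀ ξ
        linarith [hcle ξ hξ]))
  filter_upwards [this] with b hball Λ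
  rcases eq_or_ne Λ 0 with rfl | hΛ
  · rw [norm_zero, mul_zero]
    exact integral_nonneg (gibbsWeight_nonneg η b 0)
  · have hn : 0 < ‖Λ‖ := norm_pos_iff.2 hΛ
    have h1 := mul_growth_le_partition η b (‖Λ‖⁻¹ • Λ) ‖Λ‖
    rw [smul_smul, mul_inv_cancel₀ hn.ne', one_smul] at h1
    have h2 := hball (‖Λ‖⁻¹ • Λ) (by
      rw [mem_sphere_zero_iff_norm, norm_smul, norm_inv, norm_norm, inv_mul_cancel₀ hn.ne'])
    nlinarith

lemma exists_forall_partition_le {η : ℝ} {b : QSpace} (hb : b ∈ feasible η) :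
    ∃ Λ, ∀ Λ', partition η b Λ ≤ partition η b Λ' := by
  obtain ⟨c, hc, hev⟩ := exists_norm_le_partition hb
  have hcont : Continuous (partition η b) :=
    (continuous_partition η).comp (Continuous.prodMk_right b)
  exact hcont.exists_forall_le (tendsto_atTop_mono hev.self_of_nhds
    (tendsto_norm_cocompact_atTop.const_mul_atTop hc))

lemma eq_of_forall_partition_le {η : ℝ} {b : QSpace} (hb : b ∈ feasible η) {Λ Λ' : QSpace}
    (h : ∀ M, partition η b Λ ≤ partition η b M) (h' : ∀ M, partition η b Λ' ≤ partition η b M) :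
    Λ = Λ' := by
  by_contra hne
  set M : QSpace := (1 / 2 : ℝ) • (Λ + Λ') with hM
  have hi (N : QSpace) := integrable_of_continuous (continuous_gibbsWeight η b N)
  -- the defect in midpoint convexity is the integral of a weighted square
  have hsq (p : S2) : gibbsWeight η b Λ p + gibbsWeight η b Λ' p - 2 * gibbsWeight η b M p =
      max (weight η b p) 0 * (Real.exp (inner ℝ Λ (qt p - b) / 2) -
        Real.exp (inner ℝ Λ' (qt p - b) / 2)) ^ 2 := by
    have e1 : inner ℝ M (qt p - b) = inner ℝ Λ (qt p - b) / 2 + inner ℝ Λ' (qt p - b) / 2 := by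
      rw [hM, inner_smul_left_qSpace, inner_add_left]; ring
    have e2 (x : ℝ) : Real.exp x = Real.exp (x / 2) ^ 2 := by
      rw [← Real.exp_nat_mul]; congr 1; push_cast; ring
    rw [gibbsWeight, gibbsWeight, gibbsWeight, e1, Real.exp_add, e2 (inner ℝ Λ (qt p - b)),
      e2 (inner ℝ Λ' (qt p - b))]
    ring
  have hnn (p : S2) :
      0 ≤ gibbsWeight η b Λ p + gibbsWeight η b Λ' p - 2 * gibbsWeight η b M p := by
    rw [hsq]; exact mul_nonneg (le_max_right _ _) (sq_nonneg _)
  have hint : ∫ p, (gibbsWeight η b Λ p + gibbsWeight η b Λ' p - 2 * gibbsWeight η b M p) ∂surf =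
      partition η b Λ + partition η b Λ' - 2 * partition η b M := by
    refine (integral_sub' ((hi Λ).add (hi Λ')) ((hi M).const_mul 2)).trans ?_
    rw [integral_add' (hi Λ) (hi Λ'), integral_const_mul]
    rfl
  have hz : ∫ p, (gibbsWeight η b Λ p + gibbsWeight η b Λ' p - 2 * gibbsWeight η b M p) ∂surf = 0 :=
    le_antisymm (by rw [hint]; linarith [h M, h' M]) (integral_nonneg hnn)
  have hae := (integral_eq_zero_iff_of_nonneg hnn
    (((hi Λ).add (hi Λ')).sub ((hi M).const_mul 2))).1 hz
  obtain ⟨g, hg, hfin, rfl⟩ := hb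
  obtain ⟨p, hp, -, h1, h2⟩ := hg.exists_of_ae hfin
    (P := fun p => inner ℝ (Λ - Λ') (qt p) ≠ inner ℝ (Λ - Λ') (moment g) ∧
      inner ℝ (Λ - Λ') (qt p) = inner ℝ (Λ - Λ') (moment g)) (by
    have hne' : ∀ᵐ p ∂surf, inner ℝ (Λ - Λ') (qt p) ≠ inner ℝ (Λ - Λ') (moment g) := by
      rw [ae_iff]
      simpa using surf_level_qt (sub_ne_zero.2 hne) (inner ℝ (Λ - Λ') (moment g))
    filter_upwards [hae, hne'] with p hp hp' hw
    refine ⟨hp', ?_⟩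
    rw [hsq, max_eq_left hw.le, Pi.zero_apply, mul_eq_zero, or_iff_right hw.ne', sq_eq_zero_iff,
      sub_eq_zero, Real.exp_eq_exp] at hp
    rw [← sub_eq_zero, ← inner_sub_right, inner_sub_left]
    linarith)
  exact h1 h2

/-- The Lagrange multiplier of the fibre over `b`: the minimiser of the partition function,
which exists and is unique for `b ∈ feasible η`. -/
def multiplier (η : ℝ) (b : QSpace) : QSpace :=
  Classical.epsilon fun Λ => ∀ Λ', partition η b Λ ≤ partition η b Λ'

lemma partition_multiplier_le {η : ℝ} {b : QSpace} (hb : b ∈ feasible η) (Λ : QSpace) :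
    partition η b (multiplier η b) ≤ partition η b Λ :=
  Classical.epsilon_spec (p := fun Λ => ∀ Λ', partition η b Λ ≤ partition η b Λ')
    (exists_forall_partition_le hb) Λ

lemma continuousOn_multiplier (η : ℝ) : ContinuousOn (multiplier η) (feasible η) := by
  intro b₀ hb₀
  obtain ⟨c, hc, hev⟩ := exists_norm_le_partition hb₀
  have hbd : ∀ᶠ b in 𝓝 b₀, partition η b 0 < partition η b₀ 0 + 1 :=
    ((continuous_partition η).comp (Continuous.prodMk_left 0)).continuousAt.eventually
      (gt_mem_nhds (lt_add_one _))
  refine (isCompact_closedBall (0 : QSpace)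
    ((partition η b₀ 0 + 1) / c)).tendsto_nhds_of_unique_mapClusterPt ?_ ?_
  · filter_upwards [nhdsWithin_le_nhds hev, nhdsWithin_le_nhds hbd, self_mem_nhdsWithin]
      with b h1 h2 hb
    rw [mem_closedBall_zero_iff, le_div_iff₀ hc, mul_comm]
    linarith [h1 (multiplier η b), partition_multiplier_le hb 0]
  · intro Λ _ hΛ
    refine eq_of_forall_partition_le hb₀ (fun M => ?_) (partition_multiplier_le hb₀)
    by_contra hlt
    rw [not_le] at hlt
    have hcM : Continuous fun z : QSpace × QSpace => partition η z.1 M :=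
      (continuous_partition η).comp (continuous_fst.prodMk continuous_const)
    have hopen : ∀ᶠ z : QSpace × QSpace in 𝓝 (b₀, Λ), partition η z.1 M < partition η z.1 z.2 :=
      hcM.continuousAt.eventually_lt (continuous_partition η).continuousAt hlt
    rw [nhds_prod_eq, eventually_prod_iff] at hopen
    obtain ⟨pa, ha, pb, hb, hab⟩ := hopen
    have hfr := (mapClusterPt_iff_frequently.1 hΛ) _ hb
    obtain ⟨b, hb1, hb2, hb3⟩ :=
      (hfr.and_eventually ((eventually_nhdsWithin_of_eventually_nhds ha).and
        self_mem_nhdsWithin)).exists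
    exact (partition_multiplier_le hb3 M).not_gt (hab hb2 hb1)

/-- The Euler-Lagrange equation of the dual problem. -/
lemma integral_gibbsWeight_mul_inner {η : ℝ} {b : QSpace} (hb : b ∈ feasible η) (ξ : QSpace) :
    ∫ p, gibbsWeight η b (multiplier η b) p * inner ℝ ξ (qt p - b) ∂surf = 0 := by
  have hq := continuous_qt
  set Λ := multiplier η b
  set A := gibbsWeight η b Λ with hA
  set s : S2 → ℝ := fun p => inner ℝ ξ (qt p - b) with hs
  have hAc : Continuous A := continuous_gibbsWeight η b Λ
  have hsc : Continuous s := by fun_prop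
  obtain ⟨C, hC⟩ := isCompact_univ.exists_bound_of_continuousOn (f := s) hsc.continuousOn
  set X := ∫ p, A p * s p ∂surf
  set Y := ∫ p, A p * s p ^ 2 ∂surf
  have hY : 0 ≤ Y := integral_nonneg fun p =>
    mul_nonneg (gibbsWeight_nonneg η b Λ p) (sq_nonneg _)
  have hX1 : Integrable (fun p => A p * s p) surf := integrable_of_continuous (by fun_prop)
  have hY1 : Integrable (fun p => A p * s p ^ 2) surf := integrable_of_continuous (by fun_prop)
  have key (t : ℝ) (ht : |t| * (|C| + 1) ≤ 1) : 0 ≤ t * X + t ^ 2 * Y := by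
    have h1 := partition_multiplier_le hb (Λ + t • ξ)
    have h2 : partition η b (Λ + t • ξ) ≤ partition η b Λ + (t * X + t ^ 2 * Y) := by
      have hsum : ∫ p, (A p + (t * (A p * s p) + t ^ 2 * (A p * s p ^ 2))) ∂surf =
          partition η b Λ + (t * X + t ^ 2 * Y) := by
        rw [integral_add (integrable_of_continuous hAc) (integrable_of_continuous (by fun_prop)),
          integral_add (hX1.const_mul t) (hY1.const_mul _), integral_const_mul,
          integral_const_mul]
        rfl
      rw [← hsum]
      refine integral_mono (integrable_of_continuous (continuous_gibbsWeight _ _ _))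
        (integrable_of_continuous (by fun_prop)) fun p => ?_
      have h3 : gibbsWeight η b (Λ + t • ξ) p = A p * Real.exp (t * s p) := by
        rw [hA, gibbsWeight, gibbsWeight, inner_add_left, inner_smul_left_qSpace,
          Real.exp_add, mul_assoc]
      have h4 : |t * s p| ≤ 1 := by
        rw [abs_mul]
        refine (mul_le_mul_of_nonneg_left ?_ (abs_nonneg t)).trans ht
        have := hC p trivial
        rw [Real.norm_eq_abs] at this
        linarith [le_abs_self C]
      have h5 := (abs_le.1 (Real.abs_exp_sub_one_sub_id_le h4)).2
      have h6 := gibbsWeight_nonneg η b Λ p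
      simp only [h3]
      calc A p * Real.exp (t * s p) ≤ A p * (1 + t * s p + (t * s p) ^ 2) :=
            mul_le_mul_of_nonneg_left (by linarith) h6
        _ = A p + (t * (A p * s p) + t ^ 2 * (A p * s p ^ 2)) := by ring
    linarith
  by_contra hne
  have hX2 : 0 < |X| := abs_pos.2 hne
  -- the choice `t = - ε X` makes the linear term dominate
  obtain ⟨ε, hε, hε1, hε2⟩ : ∃ ε : ℝ, 0 < ε ∧ ε * (|X| * (|C| + 1)) ≤ 1 ∧ ε * Y < 1 := by
    refine ⟨1 / (|X| * (|C| + 1) + Y + 1), by positivity, ?_, ?_⟩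
    · rw [one_div_mul_eq_div, div_le_one (by positivity)]; linarith
    · rw [one_div_mul_eq_div, div_lt_one (by positivity)]
      have : 0 ≤ |X| * (|C| + 1) := by positivity
      linarith
  have h := key (-(ε * X)) (by rw [abs_neg, abs_mul, abs_of_pos hε]; linarith)
  have h1 : -(ε * X) * X + (-(ε * X)) ^ 2 * Y = ε * X ^ 2 * (ε * Y - 1) := by ring
  rw [h1] at h
  have h2 : 0 < ε * X ^ 2 := by positivity
  nlinarith

/-- The fibre minimiser: the normalised Gibbs density. -/
def fibreMin (η : ℝ) (b : QSpace) (p : S2) : ℝ :=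
  gibbsWeight η b (multiplier η b) p / partition η b (multiplier η b)

lemma continuous_fibreMin (η : ℝ) (b : QSpace) : Continuous (fibreMin η b) :=
  (continuous_gibbsWeight η b _).div_const _

lemma isDensity_fibreMin {η : ℝ} {b : QSpace} (hb : b ∈ feasible η) :
    IsDensity (fibreMin η b) := by
  have hJ := partition_pos hb (multiplier η b)
  refine ⟨integrable_of_continuous (continuous_fibreMin η b),
    ae_of_all _ fun p => div_nonneg (gibbsWeight_nonneg _ _ _ p) hJ.le, ?_⟩
  unfold fibreMin
  rw [integral_div]
  exact div_self hJ.ne'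

lemma moment_fibreMin {η : ℝ} {b : QSpace} (hb : b ∈ feasible η) :
    moment (fibreMin η b) = b := by
  have hd := isDensity_fibreMin hb
  refine ext_inner_left ℝ fun ξ => ?_
  rw [← integral_mul_inner_qt hd.1, ← sub_eq_zero]
  have h1 : ∫ p, fibreMin η b p * inner ℝ ξ (qt p - b) ∂surf = 0 := by
    have := integral_gibbsWeight_mul_inner hb ξ
    simp only [fibreMin, div_mul_eq_mul_div]
    rw [integral_div, this, zero_div]
  simp only [inner_sub_right, mul_sub] at h1
  rw [integral_sub (integrable_mul_inner_qt hd.1 ξ) (hd.1.mul_const _), integral_mul_const,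
    hd.2.2, one_mul] at h1
  exact h1

lemma weight_pos_of_fibreMin_ne_zero {η : ℝ} {b : QSpace} {p : S2} (h : fibreMin η b p ≠ 0) :
    0 < weight η b p := by
  by_contra hw
  apply h
  rw [fibreMin, gibbsWeight, max_eq_right (not_lt.1 hw), zero_mul, zero_div]

lemma log_fibreMin {η : ℝ} {b : QSpace} (hb : b ∈ feasible η) {p : S2} (hw : 0 < weight η b p) :
    Real.log (fibreMin η b p) = Real.log (weight η b p) +
      inner ℝ (multiplier η b) (qt p - b) - Real.log (partition η b (multiplier η b)) := by
  rw [fibreMin, gibbsWeight, max_eq_left hw.le, Real.log_div (by positivity)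
    (partition_pos hb _).ne', Real.log_mul hw.ne' (Real.exp_pos _).ne', Real.log_exp]

/-- **Gibbs' variational principle**: on the fibre over `b` the energy is at least minus the
logarithm of the partition function, with equality only for the Gibbs density. -/
lemma gibbs_principle {η : ℝ} {g : S2 → ℝ} (hg : IsDensity g) (hfin : energy η g < ⊤) :
    ((-Real.log (partition η (moment g) (multiplier η (moment g))) : ℝ) : EReal) ≤ energy η g ∧
    (energy η g = ((-Real.log (partition η (moment g) (multiplier η (moment g))) : ℝ) : EReal) →
      g =ᵐ[surf] fibreMin η (moment g)) := by
  obtain ⟨hw, he⟩ := of_energy_lt_top hg hfin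
  have hb : moment g ∈ feasible η := ⟨g, hg, hfin, rfl⟩
  rw [energy_eq_integral hg hw he]
  set b := moment g with hbdef
  set Λ := multiplier η b
  set L := Real.log (partition η b Λ)
  have hd := isDensity_fibreMin hb
  have hi := integrable_mul_inner_qt hg.1 Λ
  set R : S2 → ℝ := fun p => (energyDensity η b g p - (g p * inner ℝ Λ (qt p) -
    g p * inner ℝ Λ b) + g p * L) - (g p - fibreMin η b p) with hR
  have hRi : Integrable R surf :=
    ((he.sub (hi.sub (hg.1.mul_const _))).add (hg.1.mul_const _)).sub (hg.1.sub hd.1)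
  have hRint : ∫ p, R p ∂surf = ∫ p, energyDensity η b g p ∂surf + L := by
    refine (integral_sub' ((he.sub (hi.sub (hg.1.mul_const (inner ℝ Λ b)))).add
      (hg.1.mul_const L)) (hg.1.sub hd.1)).trans ?_
    rw [integral_add' (he.sub (hi.sub (hg.1.mul_const _))) (hg.1.mul_const _),
      integral_sub' he (hi.sub (hg.1.mul_const _)), integral_sub' hi (hg.1.mul_const _),
      integral_sub' hg.1 hd.1, integral_mul_const, integral_mul_const, hg.2.2, hd.2.2,
      integral_mul_inner_qt hg.1]
    ring
  have hval : ∀ᵐ p ∂surf, 0 ≤ R p ∧ (R p = 0 → g p = fibreMin η b p) := by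
    filter_upwards [hw, hg.2.1] with p hwp hgp
    by_cases hpos : 0 < weight η b p
    · have hf : 0 < fibreMin η b p :=
        div_pos (mul_pos (lt_max_of_lt_left hpos) (Real.exp_pos _)) (partition_pos hb _)
      have hlog := log_fibreMin hb hpos
      have hRp : R p = (g p * Real.log (g p) - g p * Real.log (fibreMin η b p)) -
          (g p - fibreMin η b p) := by
        rw [hlog, inner_sub_right]
        simp only [hR, energyDensity]
        ring
      rw [hRp]
      exact ⟨sub_nonneg.2 (sub_le_mul_log_sub hgp hf),
        fun h => eq_of_mul_log_sub_eq hgp hf (sub_eq_zero.1 h)⟩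
    · have h0 : g p = 0 := hwp.resolve_right hpos
      have h1 : fibreMin η b p = 0 := by
        by_contra h
        exact hpos (weight_pos_of_fibreMin_ne_zero h)
      simp [hR, energyDensity, h0, h1]
  have hR0 : 0 ≤ᵐ[surf] R := hval.mono fun p hp => hp.1
  rw [EReal.coe_le_coe_iff, EReal.coe_eq_coe_iff]
  refine ⟨by linarith [integral_nonneg_of_ae hR0], fun heq => ?_⟩
  have hz := (integral_eq_zero_iff_of_nonneg_ae hR0 hRi).1 (by rw [hRint, heq]; ring)
  filter_upwards [hz, hval] with p h1 h2 using h2.2 h1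

lemma energy_fibreMin {η : ℝ} {b : QSpace} (hb : b ∈ feasible η) :
    energy η (fibreMin η b) =
      ((-Real.log (partition η b (multiplier η b)) : ℝ) : EReal) := by
  have hq := continuous_qt
  have hd := isDensity_fibreMin hb
  have hm := moment_fibreMin hb
  set Λ := multiplier η b
  set L := Real.log (partition η b Λ)
  have he (p : S2) : energyDensity η b (fibreMin η b) p =
      fibreMin η b p * inner ℝ Λ (qt p) - fibreMin η b p * (inner ℝ Λ b + L) := by
    by_cases h : fibreMin η b p = 0
    · simp [energyDensity, h]
    · rw [energyDensity, log_fibreMin hb (weight_pos_of_fibreMin_ne_zero h), inner_sub_right]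
      ring
  have hi := integrable_mul_inner_qt hd.1 Λ
  rw [energy_eq_integral hd, hm]
  · simp_rw [he]
    rw [integral_sub hi (hd.1.mul_const _), integral_mul_inner_qt hd.1, integral_mul_const,
      hd.2.2, hm]
    congr 1; ring
  · rw [hm]
    exact ae_of_all _ fun p => or_iff_not_imp_left.2 weight_pos_of_fibreMin_ne_zero
  · rw [hm]
    exact (hi.sub (hd.1.mul_const _)).congr (ae_of_all _ fun p => (he p).symm)

/-- Convexity of the energy along a fibre. -/
lemma energy_segment_le {η : ℝ} {f g : S2 → ℝ} (hf : IsDensity f) (hg : IsDensity g)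
    (hm : moment f = moment g) {a c : ℝ} (ha : energy η f = a) (hc : energy η g = c) {t : ℝ}
    (ht0 : 0 ≤ t) (ht1 : t ≤ 1) :
    IsDensity (f + t • (g - f)) ∧ energy η (f + t • (g - f)) ≤ ((a + t * (c - a) : ℝ) : EReal) := by
  obtain ⟨hwf, hef⟩ := of_energy_lt_top hf (by rw [ha]; exact EReal.coe_lt_top a)
  obtain ⟨hwg, heg⟩ := of_energy_lt_top hg (by rw [hc]; exact EReal.coe_lt_top c)
  rw [energy_eq_integral hf hwf hef, EReal.coe_eq_coe_iff] at ha
  rw [energy_eq_integral hg hwg heg, EReal.coe_eq_coe_iff] at hc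
  set h := f + t • (g - f) with hh
  have hhp (p : S2) : h p = (1 - t) * f p + t * g p := by simp [hh]; ring
  have hhi : Integrable h surf := hf.1.add ((hg.1.sub hf.1).smul t)
  have hd : IsDensity h := by
    refine ⟨hhi, ?_, ?_⟩
    · filter_upwards [hf.2.1, hg.2.1] with p h1 h2
      rw [hhp]
      nlinarith [mul_nonneg (sub_nonneg.2 ht1) h1, mul_nonneg ht0 h2]
    · simp_rw [hhp]
      rw [integral_add (hf.1.const_mul _) (hg.1.const_mul _), integral_const_mul,
        integral_const_mul, hf.2.2, hg.2.2]
      ring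
  have hmh : moment h = moment f := by
    have h1 : moment h = (1 - t) • moment f + t • moment g := by
      simp only [moment, hhp, add_smul, mul_smul]
      refine (integral_add' ((integrable_smul_qt hf.1).smul (1 - t))
        ((integrable_smul_qt hg.1).smul t)).trans ?_
      exact congrArg₂ (· + ·) (integral_smul (1 - t) fun p => f p • qt p)
        (integral_smul t fun p => g p • qt p)
    rw [h1, ← hm, ← add_smul]; simp
  set b := moment f with hb
  rw [← hm] at hwg heg hc
  have hw : ∀ᵐ p ∂surf, h p = 0 ∨ 0 < weight η b p := by
    filter_upwards [hwf, hwg] with p h1 h2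
    rcases h1 with h1 | h1
    · rcases h2 with h2 | h2
      · left; simp [hhp, h1, h2]
      · exact Or.inr h2
    · exact Or.inr h1
  have hle : ∀ᵐ p ∂surf, energyDensity η b h p ≤
      (1 - t) * energyDensity η b f p + t * energyDensity η b g p := by
    filter_upwards [hf.2.1, hg.2.1] with p h1 h2
    have := Real.convexOn_mul_log.2 (Set.mem_Ici.2 h1) (Set.mem_Ici.2 h2) (sub_nonneg.2 ht1) ht0
      (by ring)
    simp only [smul_eq_mul] at this
    simp only [energyDensity, hhp]
    linarith
  have hub := (hef.const_mul (1 - t)).add (heg.const_mul t)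
  have heh : Integrable (energyDensity η b h) surf := by
    refine (hub.norm.add (integrable_of_continuous (continuous_weight_right η b)).norm).mono'
      (aestronglyMeasurable_energyDensity η b hhi.aestronglyMeasurable) ?_
    filter_upwards [hle, hw, hd.2.1] with p h1 h2 h3
    have h4 := neg_abs_weight_le_energyDensity (η := η) h3 h2
    simp only [Pi.add_apply, Real.norm_eq_abs]
    rw [abs_le]
    constructor
    · linarith [abs_nonneg ((1 - t) * energyDensity η b f p + t * energyDensity η b g p)]
    · linarith [le_abs_self ((1 - t) * energyDensity η b f p + t * energyDensity η b g p),
        abs_nonneg (weight η b p)]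
  refine ⟨hd, ?_⟩
  rw [energy_eq_integral hd (by rwa [hmh]) (by rwa [hmh]), hmh, EReal.coe_le_coe_iff]
  refine (integral_mono_ae heh hub hle).trans_eq ?_
  have := integral_add (hef.const_mul (1 - t)) (heg.const_mul t)
  simp only [Pi.add_apply]
  rw [this, integral_const_mul, integral_const_mul, ha, hc]
  ring

end SphereEnergy

/-! ### The divergence theorem on the sphere -/

namespace SphereEnergy

/-- Integration in polar coordinates of the product of an angular and a radial function. -/
lemma integral_polar (ρ : ℝ → ℝ) (K : E3 → ℝ) :
    ∫ x : E3, K (‖x‖⁻¹ • x) * ρ ‖x‖ =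
      (∫ p : S2, K p ∂surf) * ∫ r : Set.Ioi (0 : ℝ), ρ r
        ∂(Measure.volumeIoiPow (Module.finrank ℝ E3 - 1)) := by
  have h := (volume : Measure E3).measurePreserving_homeomorphUnitSphereProd.integral_comp
    (Homeomorph.measurableEmbedding _)
    (fun z : S2 × Set.Ioi (0 : ℝ) => K z.1 * ρ z.2)
  rw [integral_prod_mul (fun p : S2 => K p) (fun r : Set.Ioi (0 : ℝ) => ρ r)] at h
  rw [surf, ← h, ← restrict_compl_singleton (μ := (volume : Measure E3)) 0,
    ← integral_subtype_comap (measurableSet_singleton _).compl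
      (fun x : E3 => K (‖x‖⁻¹ • x) * ρ ‖x‖), restrict_compl_singleton]
  simp

/-- A bump function on the line; as a function of `‖x‖ ^ 2` it is a smooth radial cut-off supported
in an annulus around the unit sphere. -/
def radialBump : ContDiffBump (1 : ℝ) := ⟨1 / 4, 1 / 2, by norm_num, by norm_num⟩

lemma contDiff_radialBump : ContDiff ℝ 1 fun x : E3 => radialBump (‖x‖ ^ 2) :=
  radialBump.contDiff.comp (contDiff_norm_sq ℝ)

lemma norm_sq_mem_of_mem_tsupport {x : E3} (hx : x ∈ tsupport fun x : E3 => radialBump (‖x‖ ^ 2)) :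
    1 / 2 ≤ ‖x‖ ^ 2 ∧ ‖x‖ ^ 2 ≤ 3 / 2 := by
  have h1 := tsupport_comp_subset_preimage (radialBump : ℝ → ℝ) (f := fun x : E3 => ‖x‖ ^ 2)
    (by fun_prop) hx
  rw [Set.mem_preimage, radialBump.tsupport_eq, Metric.mem_closedBall, Real.dist_eq] at h1
  have h2 : radialBump.rOut = 1 / 2 := rfl
  rw [h2, abs_le] at h1
  constructor <;> linarith

lemma ne_zero_of_mem_tsupport {x : E3} (hx : x ∈ tsupport fun x : E3 => radialBump (‖x‖ ^ 2)) :
    x ≠ 0 := by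
  rintro rfl
  have := (norm_sq_mem_of_mem_tsupport hx).1
  norm_num at this

lemma hasCompactSupport_radialBump :
    HasCompactSupport fun x : E3 => radialBump (‖x‖ ^ 2) := by
  refine HasCompactSupport.of_support_subset_isCompact (isCompact_closedBall (0 : E3) 2)
    fun x hx => ?_
  have := (norm_sq_mem_of_mem_tsupport (subset_tsupport _ hx)).2
  rw [mem_closedBall_zero_iff]
  nlinarith [norm_nonneg x]

/-- A function that is continuous away from the origin becomes integrable when multiplied by the
cut-off. -/
lemma integrable_radialBump_mul {h : E3 → ℝ} (hh : ∀ x ≠ 0, ContinuousAt h x) :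
    Integrable (fun x : E3 => radialBump (‖x‖ ^ 2) * h x) := by
  refine Continuous.integrable_of_hasCompactSupport (continuous_of_tsupport fun x hx => ?_)
    hasCompactSupport_radialBump.mul_right
  have hx' : x ∈ tsupport fun x : E3 => radialBump (‖x‖ ^ 2) :=
    closure_mono (Function.support_mul_subset_left _ _) hx
  exact contDiff_radialBump.continuous.continuousAt.mul (hh x (ne_zero_of_mem_tsupport hx'))

lemma integral_radial_ne_zero :
    ∫ r : Set.Ioi (0 : ℝ), radialBump ((r : ℝ) ^ 2) * (r : ℝ)⁻¹
      ∂(Measure.volumeIoiPow (Module.finrank ℝ E3 - 1)) ≠ 0 := by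
  intro h0
  have h := integral_polar (fun r => radialBump (r ^ 2) * r⁻¹) (fun _ => 1)
  rw [h0, mul_zero] at h
  simp only [one_mul] at h
  have hnn : 0 ≤ fun x : E3 => radialBump (‖x‖ ^ 2) * ‖x‖⁻¹ :=
    fun x => mul_nonneg radialBump.nonneg (by positivity)
  have hint : Integrable fun x : E3 => radialBump (‖x‖ ^ 2) * ‖x‖⁻¹ :=
    integrable_radialBump_mul fun x hx => continuous_norm.continuousAt.inv₀ (norm_ne_zero_iff.2 hx)
  have hcont : Continuous fun x : E3 => radialBump (‖x‖ ^ 2) * ‖x‖⁻¹ := by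
    refine continuous_of_tsupport fun x hx => ?_
    have hx' : x ∈ tsupport fun x : E3 => radialBump (‖x‖ ^ 2) :=
      closure_mono (Function.support_mul_subset_left _ _) hx
    exact contDiff_radialBump.continuous.continuousAt.mul
      (continuous_norm.continuousAt.inv₀ (norm_ne_zero_iff.2 (ne_zero_of_mem_tsupport hx')))
  have hz := (Continuous.ae_eq_iff_eq volume hcont (continuous_const (y := (0 : ℝ)))).1
    ((integral_eq_zero_iff_of_nonneg hnn hint).1 h)
  have := congrFun hz (EuclideanSpace.single 0 1)
  have h1 : radialBump (1 : ℝ) = 1 :=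
    radialBump.one_of_mem_closedBall (Metric.mem_closedBall_self (by norm_num [radialBump]))
  simp [h1] at this

lemma hasFDerivAt_normalize {x : E3} (hx : x ≠ 0) :
    HasFDerivAt (fun y : E3 => ‖y‖⁻¹ • y)
      (‖x‖⁻¹ • ContinuousLinearMap.id ℝ E3 - (‖x‖⁻¹ ^ 3 • innerSL ℝ x).smulRight x) x := by
  have hn : ‖x‖ ≠ 0 := norm_ne_zero_iff.2 hx
  have h1 : HasFDerivAt (fun y : E3 => ‖y‖) (‖x‖⁻¹ • innerSL ℝ x) x := by
    have := (hasStrictFDerivAt_norm_sq x).hasFDerivAt.sqrt (pow_ne_zero 2 hn)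
    simp only [Real.sqrt_sq (norm_nonneg _)] at this
    refine this.congr_fderiv ?_
    ext v
    simp only [smul_apply, smul_eq_mul, nsmul_eq_mul, Nat.cast_ofNat]
    field_simp
  refine (((hasDerivAt_inv hn).comp_hasFDerivAt x h1).smul (hasFDerivAt_id x)).congr_fderiv ?_
  refine ContinuousLinearMap.ext fun v => ?_
  simp only [sub_apply, smul_apply,
    ContinuousLinearMap.id_apply, ContinuousLinearMap.smulRight_apply, Function.comp,
    add_apply, smul_eq_mul, id]
  rw [sub_eq_add_neg, ← neg_smul]
  congr 2
  field_simp

lemma trace_eq_sum (L : E3 →L[ℝ] E3) :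
    LinearMap.trace ℝ E3 (L : E3 →ₗ[ℝ] E3) =
      ∑ i, inner ℝ (EuclideanSpace.basisFun (Fin 3) ℝ i) (L (EuclideanSpace.basisFun (Fin 3) ℝ i)) :=
  LinearMap.trace_eq_sum_inner _ _

lemma sum_inner_smul_basisFun (x y : E3) (L : E3 →L[ℝ] E3) :
    ∑ i, inner ℝ x (EuclideanSpace.basisFun (Fin 3) ℝ i) *
      inner ℝ (EuclideanSpace.basisFun (Fin 3) ℝ i) (L y) = inner ℝ x (L y) :=
  (EuclideanSpace.basisFun (Fin 3) ℝ).sum_inner_mul_inner x (L y)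

/-- The divergence of the extension of a field that is constant along rays. -/
lemma trace_fderiv_comp_normalize {Ψ : E3 → E3} (hΨ : ContDiff ℝ 1 Ψ) {x : E3} (hx : x ≠ 0) :
    ∑ i, inner ℝ (EuclideanSpace.basisFun (Fin 3) ℝ i)
      (fderiv ℝ (fun y : E3 => Ψ (‖y‖⁻¹ • y)) x (EuclideanSpace.basisFun (Fin 3) ℝ i)) =
    surfaceDiv Ψ (‖x‖⁻¹ • x) * ‖x‖⁻¹ := by
  have hn : ‖x‖ ≠ 0 := norm_ne_zero_iff.2 hx
  have h := HasFDerivAt.comp (f := fun y : E3 => ‖y‖⁻¹ • y) x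
    ((hΨ.differentiable one_ne_zero) (‖x‖⁻¹ • x)).hasFDerivAt (hasFDerivAt_normalize hx)
  have h' : fderiv ℝ (fun y : E3 => Ψ (‖y‖⁻¹ • y)) x = _ := h.fderiv
  rw [h', surfaceDiv, trace_eq_sum]
  set L := fderiv ℝ Ψ (‖x‖⁻¹ • x)
  simp only [ContinuousLinearMap.comp_apply, sub_apply,
    smul_apply, ContinuousLinearMap.id_apply,
    ContinuousLinearMap.smulRight_apply, map_sub, map_smul, inner_sub_right, inner_smul_right,
    innerSL_apply_apply, smul_eq_mul, inner_smul_left, Finset.sum_sub_distrib]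
  have hs := sum_inner_smul_basisFun x x L
  simp only [mul_assoc]
  rw [← Finset.mul_sum, ← Finset.mul_sum, hs, real_inner_comm x (L x)]
  simp only [conj_trivial]
  ring

/-- The **divergence theorem on the sphere** for a tangential field. The field is extended to be
constant along rays, and the divergence theorem in `ℝ³` is applied to its product with a radial
cut-off function; the derivative of the cut-off is normal to the field. -/
theorem integral_surfaceDiv_eq_zero {Ψ : E3 → E3} (hΨ : ContDiff ℝ 1 Ψ)
    (htan : ∀ p : S2, inner ℝ (Ψ p) (p : E3) = 0) :
    ∫ p : S2, surfaceDiv Ψ p ∂surf = 0 := by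
  let e := EuclideanSpace.basisFun (Fin 3) ℝ
  let B : E3 → E3 := fun y => Ψ (‖y‖⁻¹ • y)
  let f : E3 → ℝ := fun x => radialBump (‖x‖ ^ 2)
  have hf : ContDiff ℝ 1 f := contDiff_radialBump
  have hB : ∀ x ≠ 0, ContDiffAt ℝ 1 B x := fun x hx =>
    hΨ.contDiffAt.comp x (((contDiffAt_norm ℝ hx).inv (norm_ne_zero_iff.2 hx)).smul contDiffAt_id)
  have hBi (i : Fin 3) : ∀ x ≠ 0, ContDiffAt ℝ 1 (fun y => inner ℝ (e i) (B y)) x :=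
    fun x hx => contDiffAt_const.inner ℝ (hB x hx)
  have hfd (i : Fin 3) {x : E3} (hx : x ≠ 0) :
      fderiv ℝ (fun y => inner ℝ (e i) (B y)) x (e i) = inner ℝ (e i) (fderiv ℝ B x (e i)) := by
    rw [fderiv_inner_apply ℝ (differentiableAt_const _) ((hB x hx).differentiableAt one_ne_zero)]
    simp
  have hf' (x : E3) (v : E3) : fderiv ℝ f x v = deriv radialBump (‖x‖ ^ 2) * (2 * inner ℝ x v) := by
    have h1 : HasDerivAt radialBump (deriv radialBump (‖x‖ ^ 2)) (‖x‖ ^ 2) :=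
      ((radialBump.contDiff (n := 1)).differentiable one_ne_zero _).hasDerivAt
    have h2 : fderiv ℝ f x = _ := (HasDerivAt.comp_hasFDerivAt (f := fun x : E3 => ‖x‖ ^ 2) x h1
      (hasStrictFDerivAt_norm_sq x).hasFDerivAt).fderiv
    rw [h2]; simp
  have hsupp {x : E3} (hx : x ∉ tsupport f) : f x = 0 ∧ fderiv ℝ f x = 0 :=
    ⟨image_eq_zero_of_notMem_tsupport hx, fderiv_of_notMem_tsupport ℝ hx⟩
  have hI1 (i : Fin 3) :
      Integrable fun x => f x * fderiv ℝ (fun y => inner ℝ (e i) (B y)) x (e i) :=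
    integrable_radialBump_mul fun x hx =>
      (((hBi i x hx).fderiv_right (m := 0) le_rfl).continuousAt).clm_apply continuousAt_const
  have hI2 (i : Fin 3) :
      Integrable fun x => fderiv ℝ f x (e i) * inner ℝ (e i) (B x) := by
    have hc : HasCompactSupport fun x => fderiv ℝ f x (e i) :=
      hasCompactSupport_radialBump.fderiv_apply (𝕜 := ℝ) (e i)
    refine Continuous.integrable_of_hasCompactSupport (continuous_of_tsupport fun x hx => ?_)
      hc.mul_right
    have hx' : x ∈ tsupport f := tsupport_fderiv_apply_subset ℝ (e i)
      (closure_mono (Function.support_mul_subset_left _ _) hx)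
    exact (((hf.continuous_fderiv one_ne_zero).clm_apply continuous_const).continuousAt).mul
      (hBi i x (ne_zero_of_mem_tsupport hx')).continuousAt
  have hI3 (i : Fin 3) : Integrable fun x => f x * inner ℝ (e i) (B x) :=
    integrable_radialBump_mul fun x hx => (hBi i x hx).continuousAt
  have hparts (i : Fin 3) :
      ∫ x, f x * fderiv ℝ (fun y => inner ℝ (e i) (B y)) x (e i) =
        -∫ x, fderiv ℝ f x (e i) * inner ℝ (e i) (B x) :=
    integral_mul_fderiv_eq_neg_fderiv_mul_of_integrable (hI2 i) (hI1 i) (hI3 i)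
      (fun x _ => hf.differentiable one_ne_zero x)
      (fun x hx => (hBi i x (ne_zero_of_mem_tsupport hx)).differentiableAt one_ne_zero)
  have hL : ∫ x, ∑ i, f x * fderiv ℝ (fun y => inner ℝ (e i) (B y)) x (e i) =
      (∫ p : S2, surfaceDiv Ψ p ∂surf) *
        ∫ r : Set.Ioi (0 : ℝ), radialBump ((r : ℝ) ^ 2) * (r : ℝ)⁻¹
          ∂(Measure.volumeIoiPow (Module.finrank ℝ E3 - 1)) := by
    rw [← integral_polar (fun r => radialBump (r ^ 2) * r⁻¹) (surfaceDiv Ψ)]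
    refine integral_congr_ae (ae_of_all _ fun x => ?_)
    by_cases hx : x ∈ tsupport f
    · have hx0 := ne_zero_of_mem_tsupport hx
      simp only [hfd _ hx0]
      rw [← Finset.mul_sum, trace_fderiv_comp_normalize hΨ hx0]
      simp only [f]; ring
    · have h0 : radialBump (‖x‖ ^ 2) = 0 := (hsupp hx).1
      simp [f, h0]
  have hR : ∫ x, ∑ i, f x * fderiv ℝ (fun y => inner ℝ (e i) (B y)) x (e i) = 0 := by
    rw [integral_finsetSum _ fun i _ => hI1 i]
    simp_rw [hparts]
    rw [Finset.sum_neg_distrib, ← integral_finsetSum _ fun i _ => hI2 i, neg_eq_zero]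
    refine integral_eq_zero_of_ae (ae_of_all _ fun x => ?_)
    by_cases hx : x ∈ tsupport f
    · have hn : ‖x‖ ≠ 0 := norm_ne_zero_iff.2 (ne_zero_of_mem_tsupport hx)
      have ht : inner ℝ x (B x) = 0 := by
        have := htan ⟨‖x‖⁻¹ • x, by simp [norm_smul, hn]⟩
        simp only [inner_smul_right] at this
        rw [real_inner_comm]
        exact (mul_eq_zero.1 this).resolve_left (inv_ne_zero hn)
      have hsum := e.sum_inner_mul_inner x (B x)
      simp only [hf', Pi.zero_apply]
      rw [ht] at hsum
      calc ∑ i, deriv radialBump (‖x‖ ^ 2) * (2 * inner ℝ x (e i)) * inner ℝ (e i) (B x)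
          = deriv radialBump (‖x‖ ^ 2) * 2 * ∑ i, inner ℝ x (e i) * inner ℝ (e i) (B x) := by
            rw [Finset.mul_sum]; exact Finset.sum_congr rfl fun i _ => by ring
        _ = 0 := by rw [hsum, mul_zero]
    · simp [(hsupp hx).2]
  rw [hL] at hR
  exact (mul_eq_zero.1 hR).resolve_right integral_radial_ne_zero

lemma continuous_surfaceDiv {Φ : E3 → E3} (hΦ : ContDiff ℝ 1 Φ) : Continuous (surfaceDiv Φ) := by
  have h := hΦ.continuous_fderiv one_ne_zero
  have h1 : surfaceDiv Φ = fun p => (∑ i, inner ℝ (EuclideanSpace.basisFun (Fin 3) ℝ i)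
      (fderiv ℝ Φ p (EuclideanSpace.basisFun (Fin 3) ℝ i))) - inner ℝ (fderiv ℝ Φ p p) p := by
    ext p; rw [surfaceDiv, trace_eq_sum]
  rw [h1]
  fun_prop

/-- Integration by parts on the sphere for a continuously differentiable function `u` with
gradient `g`. -/
lemma integral_mul_surfaceDiv {u : E3 → ℝ} (hu : ContDiff ℝ 1 u) {g : E3 → E3}
    (hg : ∀ x v, fderiv ℝ u x v = inner ℝ (g x) v) (hgc : Continuous g) {Φ : E3 → E3}
    (hΦ : ContDiff ℝ 1 Φ) (htan : ∀ p : S2, inner ℝ (Φ p) (p : E3) = 0) :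
    ∫ p : S2, u p * surfaceDiv Φ p ∂surf = -∫ p : S2, inner ℝ (g p) (Φ p) ∂surf := by
  have h0 := integral_surfaceDiv_eq_zero (hu.smul hΦ) fun p => by
    simp [inner_smul_left, htan]
  have hdiv (p : S2) : surfaceDiv (fun x => u x • Φ x) p =
      u p * surfaceDiv Φ p + inner ℝ (g p) (Φ p) := by
    have hfd := fderiv_fun_smul (𝕜 := ℝ) (hu.differentiable one_ne_zero p)
      (hΦ.differentiable one_ne_zero p)
    rw [surfaceDiv, surfaceDiv, trace_eq_sum, trace_eq_sum, hfd]
    have hsum := (EuclideanSpace.basisFun (Fin 3) ℝ).sum_inner_mul_inner (g p) (Φ p)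
    simp only [add_apply, smul_apply,
      ContinuousLinearMap.smulRight_apply, hg, inner_add_right, inner_smul_right, inner_add_left,
      inner_smul_left, htan, Finset.sum_add_distrib, conj_trivial, hsum]
    rw [← Finset.mul_sum]
    ring
  have hc1 := hu.continuous
  have hc2 := continuous_surfaceDiv hΦ
  have hc3 := hΦ.continuous
  have h1 : ∫ p : S2, surfaceDiv (fun x => u x • Φ x) p ∂surf = 0 := h0
  simp_rw [hdiv] at h1
  rw [integral_add (integrable_of_continuous (by fun_prop))
    (integrable_of_continuous (by fun_prop))] at h1
  linarith

end SphereEnergy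

/-! ### The norms of the function spaces -/

namespace SphereEnergy

lemma integrable_inner {G Φ : S2 → E3} (hG : Integrable G surf) (hΦ : Continuous Φ) :
    Integrable (fun p => inner ℝ (G p) (Φ p)) surf := by
  obtain ⟨C, hC⟩ := isCompact_univ.exists_bound_of_continuousOn (f := Φ) hΦ.continuousOn
  refine (hG.norm.mul_const C).mono'
    (hG.aestronglyMeasurable.inner hΦ.aestronglyMeasurable) (ae_of_all _ fun p => ?_)
  exact (norm_inner_le_norm _ _).trans (mul_le_mul_of_nonneg_left (hC p trivial) (norm_nonneg _))

lemma integrable_mul_continuous {u h : S2 → ℝ} (hu : Integrable u surf) (hh : Continuous h) :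
    Integrable (fun p => u p * h p) surf := by
  obtain ⟨C, hC⟩ := isCompact_univ.exists_bound_of_continuousOn (f := h) hh.continuousOn
  exact hu.mul_bdd (c := C) hh.aestronglyMeasurable (ae_of_all _ fun p => hC p trivial)

lemma IsWeakGradient.sub {u v : S2 → ℝ} {G H : S2 → E3} (hu : IsWeakGradient u G)
    (hv : IsWeakGradient v H) : IsWeakGradient (u - v) (G - H) := by
  refine ⟨hu.1.sub hv.1, hu.2.1.sub hv.2.1, ?_, fun Φ hΦ htan => ?_⟩
  · filter_upwards [hu.2.2.1, hv.2.2.1] with p h1 h2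
    simp [inner_sub_left, h1, h2]
  · have hd : Continuous fun p : S2 => surfaceDiv Φ p :=
      (continuous_surfaceDiv (hΦ.of_le (by simp))).comp continuous_subtype_val
    have hc : Continuous fun p : S2 => Φ p := hΦ.continuous.comp continuous_subtype_val
    simp only [Pi.sub_apply, sub_mul, inner_sub_left]
    rw [integral_sub (integrable_mul_continuous hu.1 hd) (integrable_mul_continuous hv.1 hd),
      integral_sub (integrable_inner hu.2.1 hc) (integrable_inner hv.2.1 hc),
      hu.2.2.2 Φ hΦ htan, hv.2.2.2 Φ hΦ htan]
    ring

lemma IsWeakGradient.smul {u : S2 → ℝ} {G : S2 → E3} (hu : IsWeakGradient u G) (t : ℝ) :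
    IsWeakGradient (t • u) (t • G) := by
  refine ⟨hu.1.smul t, hu.2.1.smul t, ?_, fun Φ hΦ htan => ?_⟩
  · filter_upwards [hu.2.2.1] with p h1
    simp [inner_smul_left, h1]
  · have h := hu.2.2.2 Φ hΦ htan
    simp only [Pi.smul_apply, inner_smul_left, smul_eq_mul, mul_assoc, conj_trivial]
    rw [integral_const_mul, integral_const_mul, h]
    ring

lemma IsWeakGradient.congr {u v : S2 → ℝ} {G : S2 → E3} (hu : IsWeakGradient u G)
    (h : u =ᵐ[surf] v) : IsWeakGradient v G := by
  refine ⟨hu.1.congr h, hu.2.1, hu.2.2.1, fun Φ hΦ htan => ?_⟩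
  rw [← hu.2.2.2 Φ hΦ htan]
  exact integral_congr_ae (h.mono fun p hp => by simp only [hp])

lemma sobolevNorm_le {q : ℝ≥0∞} {u : S2 → ℝ} {G : S2 → E3} (h : IsWeakGradient u G) :
    sobolevNorm q u ≤ eLpNorm u q surf + eLpNorm G q surf :=
  iInf₂_le G h

lemma holderNorm_le {α : ℝ≥0} {u v : S2 → ℝ} (hv : Continuous v) (h : v =ᵐ[surf] u) :
    holderNorm α u ≤ (⨆ p, ‖v p‖ₑ) + eHolderNorm α v :=
  (iInf_le _ v).trans (iInf₂_le hv h)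

lemma FunctionSpace.eNorm_congr (X : FunctionSpace) {u v : S2 → ℝ} (h : u =ᵐ[surf] v) :
    X.eNorm u = X.eNorm v := by
  cases X with
  | lebesgue q hq => exact eLpNorm_congr_ae h
  | holder α hα =>
    simp only [FunctionSpace.eNorm, holderNorm]
    refine iInf_congr fun w => iInf_congr fun _ => ?_
    exact iInf_congr_Prop ⟨fun hw => hw.trans h, fun hw => hw.trans h.symm⟩ fun _ => rfl
  | sobolev q hq hq' =>
    simp only [FunctionSpace.eNorm, sobolevNorm, eLpNorm_congr_ae h]
    refine iInf_congr fun G => ?_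
    exact iInf_congr_Prop ⟨fun hG => hG.congr h, fun hG => hG.congr h.symm⟩ fun _ => rfl

/-- Every space of the list is continuously embedded in `L¹`. -/
lemma FunctionSpace.exists_eLpNorm_one_le (X : FunctionSpace) :
    ∃ C : ℝ≥0∞, C ≠ ⊤ ∧ ∀ u, AEStronglyMeasurable u surf →
      eLpNorm u 1 surf ≤ X.eNorm u * C := by
  have hμ {q : ℝ≥0∞} (hq : 1 ≤ q) :
      surf Set.univ ^ (1 / (1 : ℝ≥0∞).toReal - 1 / q.toReal) ≠ ⊤ := by
    refine ENNReal.rpow_ne_top_of_nonneg ?_ (measure_ne_top _ _)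
    rcases eq_or_ne q ⊤ with rfl | h
    · simp
    · have : 1 ≤ q.toReal := by
        rw [← ENNReal.toReal_one]
        exact (ENNReal.toReal_le_toReal ENNReal.one_ne_top h).2 hq
      simpa using inv_le_one_of_one_le₀ this
  cases X with
  | lebesgue q hq =>
    exact ⟨_, hμ hq, fun u hu => eLpNorm_le_eLpNorm_mul_rpow_measure_univ hq hu⟩
  | holder α hα =>
    have hC : surf Set.univ + 1 ≠ ⊤ := ENNReal.add_ne_top.2 ⟨measure_ne_top _ _, by simp⟩
    refine ⟨surf Set.univ + 1, hC, fun u _ => (ENNReal.div_le_iff (by simp) hC).1 ?_⟩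
    refine le_iInf fun v => le_iInf₂ fun _ hvu => ENNReal.div_le_of_le_mul ?_
    rw [← eLpNorm_congr_ae hvu, eLpNorm_one_eq_lintegral_enorm]
    calc ∫⁻ p, ‖v p‖ₑ ∂surf ≤ ∫⁻ _, (⨆ p, ‖v p‖ₑ) ∂surf :=
          lintegral_mono fun p => le_iSup (fun p => ‖v p‖ₑ) p
      _ = (⨆ p, ‖v p‖ₑ) * surf Set.univ := lintegral_const _
      _ ≤ _ := mul_le_mul' le_self_add le_self_add
  | sobolev q hq hq' =>
    refine ⟨_, hμ hq, fun u hu =>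
      (eLpNorm_le_eLpNorm_mul_rpow_measure_univ hq hu).trans (mul_le_mul_left ?_ _)⟩
    exact le_iInf₂ fun G _ => le_self_add

/-- Scaling in the function spaces: differences of elements tend to zero when multiplied by
scalars that tend to zero. -/
lemma FunctionSpace.exists_eNorm_smul_sub_le (X : FunctionSpace) {f g : S2 → ℝ}
    (hf : Integrable f surf) (hg : Integrable g surf) (hXf : X.eNorm f < ⊤)
    (hXg : X.eNorm g < ⊤) : ∃ C : ℝ≥0∞, C ≠ ⊤ ∧ ∀ t : ℝ, X.eNorm (t • (g - f)) ≤ ‖t‖ₑ * C := by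
  have hLp {q : ℝ≥0∞} {E : Type} [NormedAddCommGroup E] {u v : S2 → E}
      (hu : AEStronglyMeasurable u surf) (hv : AEStronglyMeasurable v surf)
      (h1 : eLpNorm u q surf < ⊤) (h2 : eLpNorm v q surf < ⊤) :
      eLpNorm (u - v) q surf ≠ ⊤ :=
    (MemLp.sub (p := q) ⟨hu, h1⟩ ⟨hv, h2⟩).2.ne
  cases X with
  | lebesgue q hq =>
    exact ⟨_, hLp hg.aestronglyMeasurable hf.aestronglyMeasurable hXg hXf,
      fun t => eLpNorm_const_smul_le⟩
  | holder α hα =>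
    simp only [FunctionSpace.eNorm, holderNorm, iInf_lt_iff] at hXf hXg
    obtain ⟨v, hv, hvf, hvlt⟩ := hXf
    obtain ⟨w, hw, hwg, hwlt⟩ := hXg
    refine ⟨(⨆ p, ‖(w - v) p‖ₑ) + eHolderNorm α (w - v), ?_, fun t => ?_⟩
    · rw [ENNReal.add_ne_top] at *
      refine ⟨?_, ?_⟩
      · obtain ⟨C, hC⟩ := isCompact_univ.exists_bound_of_continuousOn (hw.sub hv).continuousOn
        refine ne_top_of_le_ne_top (ENNReal.ofReal_ne_top (r := C)) (iSup_le fun p => ?_)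
        exact by
          rw [← ofReal_norm]; exact ENNReal.ofReal_le_ofReal (hC p trivial)
      · have h1 : MemHolder α v := eHolderNorm_lt_top.1 (ENNReal.add_lt_top.1 hvlt).2
        have h2 : MemHolder α w := eHolderNorm_lt_top.1 (ENNReal.add_lt_top.1 hwlt).2
        rw [sub_eq_add_neg, ← neg_one_smul ℝ v]
        exact eHolderNorm_ne_top.2 (h2.add h1.smul)
    · refine (holderNorm_le (v := t • (w - v)) ((hw.sub hv).const_smul t) ?_).trans ?_
      · filter_upwards [hvf, hwg] with p h1 h2
        simp [h1, h2]
      · rw [eHolderNorm_smul, mul_add, ENNReal.mul_iSup]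
        simp only [Pi.smul_apply, enorm_smul]
        rfl
  | sobolev q hq hq' =>
    simp only [FunctionSpace.eNorm, sobolevNorm, iInf_lt_iff] at hXf hXg
    obtain ⟨G, hG, hGlt⟩ := hXf
    obtain ⟨H, hH, hHlt⟩ := hXg
    rw [ENNReal.add_lt_top] at hGlt hHlt
    refine ⟨eLpNorm (g - f) q surf + eLpNorm (H - G) q surf, ENNReal.add_ne_top.2
      ⟨hLp hg.aestronglyMeasurable hf.aestronglyMeasurable hHlt.1 hGlt.1,
       hLp hH.2.1.aestronglyMeasurable hG.2.1.aestronglyMeasurable hHlt.2 hGlt.2⟩, fun t => ?_⟩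
    refine (sobolevNorm_le ((hH.sub hG).smul t)).trans ?_
    rw [mul_add]
    exact add_le_add eLpNorm_const_smul_le eLpNorm_const_smul_le

/-- Interpolation, for `α < 1`, between the supremum norm and the Lipschitz seminorm. -/
lemma holderNorm_le_of_lipschitz {α : ℝ≥0} (hα : α < 1) {d : S2 → ℝ} {δ L : ℝ≥0}
    (hδ : ∀ p, ‖d p‖ₑ ≤ δ) (hL : LipschitzWith L d) :
    holderNorm α d ≤ ((δ + (2 * δ) ^ (1 - α : ℝ) * L ^ (α : ℝ) : ℝ≥0) : ℝ≥0∞) := by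
  have hα' : (0 : ℝ) < 1 - α := sub_pos.2 (by exact_mod_cast hα)
  refine (holderNorm_le hL.continuous (Filter.EventuallyEq.refl _ _)).trans ?_
  rw [ENNReal.coe_add]
  refine add_le_add (iSup_le hδ) (HolderWith.eHolderNorm_le fun p q => ?_)
  have h1 : edist (d p) (d q) ≤ ((2 * δ : ℝ≥0) : ℝ≥0∞) := by
    rw [edist_eq_enorm_sub]
    refine (enorm_sub_le).trans ((add_le_add (hδ p) (hδ q)).trans_eq ?_)
    push_cast; ring
  calc edist (d p) (d q)
      = edist (d p) (d q) ^ (1 - α : ℝ) * edist (d p) (d q) ^ (α : ℝ) := by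
        rw [← ENNReal.rpow_add_of_nonneg (1 - α : ℝ) (α : ℝ) hα'.le α.coe_nonneg]; simp
    _ ≤ ((2 * δ : ℝ≥0) : ℝ≥0∞) ^ (1 - α : ℝ) * (L * edist p q) ^ (α : ℝ) :=
        mul_le_mul' (ENNReal.rpow_le_rpow h1 hα'.le) (ENNReal.rpow_le_rpow (hL p q) α.coe_nonneg)
    _ = _ := by
        rw [ENNReal.mul_rpow_of_nonneg _ _ α.coe_nonneg, ← mul_assoc,
          ENNReal.coe_mul ((2 * δ) ^ (1 - α : ℝ)),
          ENNReal.coe_rpow_of_nonneg _ hα'.le, ENNReal.coe_rpow_of_nonneg _ α.coe_nonneg]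

end SphereEnergy

/-! ### The family of Gibbs densities in the function spaces -/

namespace SphereEnergy

/-- The parameters of the Gibbs densities: the tensor in the weight, the multiplier, and the
logarithm of the normalisation. -/
abbrev Param : Type := E9 × E9 × ℝ

/-- The polynomial whose positive part is the weight. -/
def profileWeight (η : ℝ) (θ : Param) (x : E3) : ℝ := inner ℝ θ.1 (qTensor x) - η

/-- The exponential factor of the Gibbs densities. -/
def profileExp (θ : Param) (x : E3) : ℝ := Real.exp (inner ℝ θ.2.1 (qTensor x) + θ.2.2)

/-- The Gibbs densities as functions on `ℝ³`. -/
def profile (η : ℝ) (θ : Param) (x : E3) : ℝ := max (profileWeight η θ x) 0 * profileExp θ x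

lemma contDiff_profileWeight (η : ℝ) :
    ContDiff ℝ 1 fun z : Param × E3 => profileWeight η z.1 z.2 :=
  ((contDiff_fst.comp contDiff_fst).inner ℝ
    ((contDiff_qTensor.of_le (by simp)).comp contDiff_snd)).sub contDiff_const

lemma contDiff_profileExp : ContDiff ℝ 1 fun z : Param × E3 => profileExp z.1 z.2 :=
  (((contDiff_fst.comp (contDiff_snd.comp contDiff_fst)).inner ℝ
    ((contDiff_qTensor.of_le (by simp)).comp contDiff_snd)).add
      (contDiff_snd.comp (contDiff_snd.comp contDiff_fst))).exp

/-- The orthogonal projection of `v` to the tangent space at `p`. -/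
def tangential (p v : E3) : E3 := v - inner ℝ v p • p

lemma tangential_add (p v w : E3) : tangential p (v + w) = tangential p v + tangential p w := by
  simp only [tangential, inner_add_left, add_smul]; abel

lemma tangential_smul (p : E3) (c : ℝ) (v : E3) : tangential p (c • v) = c • tangential p v := by
  simp only [tangential, inner_smul_left, smul_sub, smul_smul, conj_trivial]

lemma inner_tangential_self (p : S2) (v : E3) : inner ℝ (tangential p v) (p : E3) = 0 := by
  simp [tangential, inner_sub_left, inner_smul_left]

lemma inner_tangential {p v w : E3} (h : inner ℝ w p = 0) :
    inner ℝ (tangential p v) w = inner ℝ v w := by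
  rw [tangential, inner_sub_left, inner_smul_left, real_inner_comm, real_inner_comm w p, h]
  simp

/-- A smooth approximation of the positive part; for `ε = 0` it is the positive part. -/
def softPos (ε t : ℝ) : ℝ := (t + √(t ^ 2 + ε ^ 2)) / 2

/-- The derivative of `softPos`. For `ε = 0` it is the Heaviside function, with the value `1 / 2`
at `0` because of the convention `0 / 0 = 0`. -/
def softStep (ε t : ℝ) : ℝ := (1 + t / √(t ^ 2 + ε ^ 2)) / 2

lemma softPos_zero (t : ℝ) : softPos 0 t = max t 0 := by
  rw [softPos, zero_pow two_ne_zero, add_zero, Real.sqrt_sq_eq_abs]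
  rcases le_total 0 t with h | h
  · rw [abs_of_nonneg h, max_eq_left h]; ring
  · rw [abs_of_nonpos h, max_eq_right h]; ring

lemma abs_softStep_le (ε t : ℝ) : |softStep ε t| ≤ 1 := by
  have h1 : |t| ≤ √(t ^ 2 + ε ^ 2) := Real.abs_le_sqrt (by nlinarith [sq_nonneg ε])
  have h2 : |t / √(t ^ 2 + ε ^ 2)| ≤ 1 := by
    rw [abs_div, abs_of_nonneg (Real.sqrt_nonneg _)]
    exact div_le_one_of_le₀ h1 (Real.sqrt_nonneg _)
  rw [abs_le] at h2 ⊢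
  rw [softStep]
  constructor <;> linarith

lemma abs_softPos_le {ε : ℝ} (h0 : 0 ≤ ε) (h1 : ε ≤ 1) (t : ℝ) : |softPos ε t| ≤ |t| + 1 := by
  have h2 : √(t ^ 2 + ε ^ 2) ≤ |t| + 1 := by
    rw [Real.sqrt_le_left (by positivity)]
    nlinarith [sq_abs t, abs_nonneg t]
  rw [softPos, abs_le]
  constructor <;> linarith [Real.sqrt_nonneg (t ^ 2 + ε ^ 2), le_abs_self t, neg_abs_le t]

lemma contDiff_softPos {ε : ℝ} (hε : 0 < ε) : ContDiff ℝ 1 (softPos ε) := by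
  unfold softPos
  refine (contDiff_id.add (ContDiff.sqrt (by fun_prop) fun t => ?_)).div_const 2
  positivity

lemma hasDerivAt_softPos {ε : ℝ} (hε : 0 < ε) (t : ℝ) :
    HasDerivAt (softPos ε) (softStep ε t) t := by
  have hpos : 0 < t ^ 2 + ε ^ 2 := by positivity
  have h1 : HasDerivAt (fun t : ℝ => t ^ 2 + ε ^ 2) (2 * t) t := by
    simpa using ((hasDerivAt_id t).pow 2).add_const (ε ^ 2)
  have h2 := ((hasDerivAt_id t).add (h1.sqrt hpos.ne')).div_const 2
  refine h2.congr_deriv ?_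
  rw [softStep]
  have := (Real.sqrt_pos.2 hpos).ne'
  field_simp

lemma continuous_softStep {ε : ℝ} (hε : 0 < ε) : Continuous (softStep ε) := by
  unfold softStep
  refine (continuous_const.add (continuous_id.div (by fun_prop) fun t => ?_)).div_const 2
  have : 0 < t ^ 2 + ε ^ 2 := by positivity
  exact (Real.sqrt_pos.2 this).ne'

lemma tendsto_softPos (t : ℝ) : Tendsto (fun ε => softPos ε t) (𝓝 0) (𝓝 (max t 0)) := by
  have : Continuous fun ε => softPos ε t := by unfold softPos; fun_prop
  simpa [softPos_zero] using this.tendsto 0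

lemma tendsto_softStep (t : ℝ) : Tendsto (fun ε => softStep ε t) (𝓝 0) (𝓝 (softStep 0 t)) := by
  rcases eq_or_ne t 0 with rfl | ht
  · simp [softStep]
  · have : ContinuousAt (fun ε => softStep ε t) 0 := by
      unfold softStep
      refine ContinuousAt.div_const (continuousAt_const.add
        (continuousAt_const.div (by fun_prop) ?_)) 2
      have : 0 < t ^ 2 := by positivity
      simpa [Real.sqrt_sq_eq_abs] using ht
    exact this

lemma continuousAt_softStep_zero {t : ℝ} (ht : t ≠ 0) : ContinuousAt (softStep 0) t := by
  unfold softStep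
  refine ContinuousAt.div_const (continuousAt_const.add
    (continuousAt_id.div (by fun_prop) ?_)) 2
  simpa [Real.sqrt_sq_eq_abs] using ht

lemma measurable_softStep (ε : ℝ) : Measurable (softStep ε) := by
  unfold softStep; fun_prop

/-- The transpose of the derivative of `qTensor`. -/
def qTensorAdjoint (x : E3) : E9 →L[ℝ] E3 := ContinuousLinearMap.adjoint (fderiv ℝ qTensor x)

lemma continuous_qTensorAdjoint : Continuous qTensorAdjoint :=
  (ContinuousLinearMap.adjoint (𝕜 := ℝ) (E := E3) (F := E9)).continuous.comp
    (contDiff_qTensor.continuous_fderiv (by simp))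

lemma inner_qTensorAdjoint (x v : E3) (a : E9) :
    inner ℝ (qTensorAdjoint x a) v = inner ℝ a (fderiv ℝ qTensor x v) :=
  ContinuousLinearMap.adjoint_inner_left _ _ _

/-- The coefficient of the Heaviside function in the gradient of a Gibbs density. -/
def gradStep (θ : Param) (x : E3) : E3 := profileExp θ x • qTensorAdjoint x θ.1

/-- The coefficient of the positive part in the gradient of a Gibbs density. -/
def gradPos (θ : Param) (x : E3) : E3 := profileExp θ x • qTensorAdjoint x θ.2.1

/-- The tangential gradient of a Gibbs density. -/
def profileGrad (η : ℝ) (θ : Param) (p : S2) : E3 :=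
  tangential p (softStep 0 (profileWeight η θ p) • gradStep θ p +
    max (profileWeight η θ p) 0 • gradPos θ p)

lemma continuous_gradStep : Continuous fun z : Param × E3 => gradStep z.1 z.2 := by
  have h1 := contDiff_profileExp.continuous
  have h2 := continuous_qTensorAdjoint
  unfold gradStep
  exact h1.smul ((h2.comp continuous_snd).clm_apply (by fun_prop))

lemma continuous_gradPos : Continuous fun z : Param × E3 => gradPos z.1 z.2 := by
  have h1 := contDiff_profileExp.continuous
  have h2 := continuous_qTensorAdjoint
  unfold gradPos
  exact h1.smul ((h2.comp continuous_snd).clm_apply (by fun_prop))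

lemma fderiv_soft_profile {ε : ℝ} (hε : 0 < ε) (η : ℝ) (θ : Param) (x v : E3) :
    fderiv ℝ (fun x => softPos ε (profileWeight η θ x) * profileExp θ x) x v =
      inner ℝ (softStep ε (profileWeight η θ x) • gradStep θ x +
        softPos ε (profileWeight η θ x) • gradPos θ x) v := by
  have hq : HasFDerivAt qTensor (fderiv ℝ qTensor x) x :=
    (contDiff_qTensor.differentiable (by simp) x).hasFDerivAt
  have hW := (innerSL ℝ θ.1).hasFDerivAt.comp x hq
  have hE := (innerSL ℝ θ.2.1).hasFDerivAt.comp x hq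
  have h1 : HasFDerivAt (fun x => softPos ε (profileWeight η θ x)) _ x :=
    HasDerivAt.comp_hasFDerivAt x (hasDerivAt_softPos hε _) (hW.sub_const η)
  have h2 : HasFDerivAt (profileExp θ) _ x := (hE.add_const θ.2.2).exp
  have h3 : fderiv ℝ (fun x => softPos ε (profileWeight η θ x) * profileExp θ x) x = _ :=
    (h1.mul h2).fderiv
  rw [h3]
  simp only [add_apply, smul_apply, ContinuousLinearMap.comp_apply, innerSL_apply_apply,
    inner_add_left, inner_smul_left, gradStep, gradPos, inner_qTensorAdjoint, smul_eq_mul,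
    conj_trivial, Function.comp, profileExp, profileWeight]
  ring

-- The unifier would otherwise unfold the inner products and the exponential.
attribute [irreducible] profileWeight profileExp

lemma locallyLipschitz_profile (η : ℝ) :
    LocallyLipschitz fun z : Param × E3 => profile η z.1 z.2 := by
  have h1 := (contDiff_profileWeight η).locallyLipschitz.max_const 0
  have h2 := contDiff_profileExp.locallyLipschitz
  have h3 : ContDiff ℝ 1 fun z : ℝ × ℝ => z.1 * z.2 := contDiff_fst.mul contDiff_snd
  exact h3.locallyLipschitz.comp (h1.prodMk h2)

lemma continuous_profile (η : ℝ) (θ : Param) : Continuous (profile η θ) := by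
  have h := (locallyLipschitz_profile η).continuous.comp
    (continuous_const.prodMk continuous_id : Continuous fun x : E3 => (θ, x))
  exact h

/-- Near a parameter the Gibbs densities are Lipschitz, jointly in the parameter and the point. -/
lemma exists_lipschitz_profile (η : ℝ) (θ₀ : Param) : ∃ K : ℝ≥0,
    (∀ θ ∈ Metric.closedBall θ₀ 1, LipschitzWith K fun p : S2 => profile η θ p) ∧
    ∀ θ ∈ Metric.closedBall θ₀ 1, ∀ p : S2, ‖profile η θ p - profile η θ₀ p‖ₑ ≤ K * edist θ θ₀ := by
  have hK : IsCompact (Metric.closedBall θ₀ 1 ×ˢ Metric.sphere (0 : E3) 1) :=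
    (isCompact_closedBall _ _).prod (isCompact_sphere _ _)
  obtain ⟨K, hL⟩ := LocallyLipschitzOn.exists_lipschitzOnWith_of_compact hK
    ((locallyLipschitz_profile η).locallyLipschitzOn)
  have hmem {θ : Param} (hθ : θ ∈ Metric.closedBall θ₀ 1) (p : S2) :
      (θ, (p : E3)) ∈ Metric.closedBall θ₀ 1 ×ˢ Metric.sphere (0 : E3) 1 := ⟨hθ, p.2⟩
  refine ⟨K, fun θ hθ p q => ?_, fun θ hθ p => ?_⟩
  · have h := hL (hmem hθ p) (hmem hθ q)
    rw [Prod.edist_eq, edist_self, max_eq_right zero_le] at h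
    exact h
  · have h := hL (hmem hθ p) (hmem (Metric.mem_closedBall_self zero_le_one) p)
    rw [Prod.edist_eq, edist_self, max_eq_left zero_le, edist_eq_enorm_sub] at h
    exact h

/-- The gradients of the smooth approximations converge boundedly and at every point, which is why
no assumption on the zero set of the weight is needed here. -/
lemma isWeakGradient_profile (η : ℝ) (θ : Param) :
    IsWeakGradient (fun p : S2 => profile η θ p) (profileGrad η θ) := by
  have hPc : Continuous fun p : S2 => profileWeight η θ p :=
    ((contDiff_profileWeight η).continuous.comp (Continuous.prodMk_right θ)).comp
      continuous_subtype_val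
  have hEc : Continuous fun p : S2 => profileExp θ p :=
    (contDiff_profileExp.continuous.comp (Continuous.prodMk_right θ)).comp continuous_subtype_val
  have hAc : Continuous fun p : S2 => gradStep θ p :=
    (continuous_gradStep.comp (Continuous.prodMk_right θ)).comp continuous_subtype_val
  have hBc : Continuous fun p : S2 => gradPos θ p :=
    (continuous_gradPos.comp (Continuous.prodMk_right θ)).comp continuous_subtype_val
  have hsc : Continuous fun p : S2 => (p : E3) := continuous_subtype_val
  have hstep : Measurable fun p : S2 => softStep 0 (profileWeight η θ p) :=
    (measurable_softStep 0).comp hPc.measurable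
  refine ⟨integrable_of_continuous ((continuous_profile η θ).comp hsc), ?_,
    ae_of_all _ fun p => inner_tangential_self p _, fun Φ hΦ htan => ?_⟩
  · have h1 : Integrable (fun p : S2 => softStep 0 (profileWeight η θ p) •
        tangential p (gradStep θ p)) surf := by
      refine Integrable.bdd_smul (C := 1) ?_ hstep.aestronglyMeasurable
        (ae_of_all _ fun p => abs_softStep_le _ _)
      exact integrable_of_continuous (by unfold tangential; fun_prop)
    have h2 : Integrable (fun p : S2 => max (profileWeight η θ p) 0 •
        tangential p (gradPos θ p)) surf :=
      integrable_of_continuous (by unfold tangential; fun_prop)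
    refine (h1.add h2).congr (ae_of_all _ fun p => ?_)
    simp [profileGrad, tangential_add, tangential_smul]
  · have hΦ1 : ContDiff ℝ 1 Φ := hΦ.of_le (by simp)
    have hdc : Continuous fun p : S2 => surfaceDiv Φ p :=
      (continuous_surfaceDiv hΦ1).comp hsc
    have hΦc : Continuous fun p : S2 => Φ p := hΦ.continuous.comp hsc
    let ε : ℕ → ℝ := fun n => 1 / ((n : ℝ) + 1)
    have hε0 (n : ℕ) : 0 < ε n := by positivity
    have hε1 (n : ℕ) : ε n ≤ 1 := by
      rw [div_le_one (by positivity)]; linarith [n.cast_nonneg (α := ℝ)]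
    have hεt : Tendsto ε atTop (𝓝 0) := tendsto_one_div_add_atTop_nhds_zero_nat
    have happrox (n : ℕ) :
        ∫ p : S2, softPos (ε n) (profileWeight η θ p) * profileExp θ p * surfaceDiv Φ p ∂surf =
          -∫ p : S2, (softStep (ε n) (profileWeight η θ p) * inner ℝ (gradStep θ p) (Φ p) +
            softPos (ε n) (profileWeight η θ p) * inner ℝ (gradPos θ p) (Φ p)) ∂surf := by
      have hW : ContDiff ℝ 1 fun x : E3 => profileWeight η θ x :=
        (contDiff_profileWeight η).comp (contDiff_const.prodMk contDiff_id)
      have hE : ContDiff ℝ 1 fun x : E3 => profileExp θ x :=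
        contDiff_profileExp.comp (contDiff_const.prodMk contDiff_id)
      have hA : Continuous fun x : E3 => gradStep θ x := by
        have h := continuous_gradStep.comp
          (continuous_const.prodMk continuous_id : Continuous fun x : E3 => (θ, x))
        exact h
      have hB : Continuous fun x : E3 => gradPos θ x := by
        have h := continuous_gradPos.comp
          (continuous_const.prodMk continuous_id : Continuous fun x : E3 => (θ, x))
        exact h
      have h := integral_mul_surfaceDiv (((contDiff_softPos (hε0 n)).comp hW).mul hE)
        (g := fun x => softStep (ε n) (profileWeight η θ x) • gradStep θ x +
          softPos (ε n) (profileWeight η θ x) • gradPos θ x)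
        (fderiv_soft_profile (hε0 n) η θ)
        ((((continuous_softStep (hε0 n)).comp hW.continuous).smul hA).add
          (((contDiff_softPos (hε0 n)).continuous.comp hW.continuous).smul hB)) hΦ1 htan
      simpa [inner_add_left, inner_smul_left] using h
    have hL : Tendsto (fun n => ∫ p : S2, softPos (ε n) (profileWeight η θ p) * profileExp θ p *
        surfaceDiv Φ p ∂surf) atTop (𝓝 (∫ p : S2, profile η θ p * surfaceDiv Φ p ∂surf)) := by
      refine tendsto_integral_of_dominated_convergence
        (fun p : S2 => (|profileWeight η θ p| + 1) * |profileExp θ p| * |surfaceDiv Φ p|)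
        (fun n => ?_) (integrable_of_continuous (by fun_prop)) (fun n => ae_of_all _ fun p => ?_)
        (ae_of_all _ fun p => ?_)
      · have := (contDiff_softPos (hε0 n)).continuous
        exact Continuous.aestronglyMeasurable (by fun_prop)
      · rw [Real.norm_eq_abs, abs_mul, abs_mul]
        gcongr
        exact abs_softPos_le (hε0 n).le (hε1 n) _
      · exact (((tendsto_softPos _).comp hεt).mul_const _).mul_const _
    have hR : Tendsto (fun n => ∫ p : S2, (softStep (ε n) (profileWeight η θ p) *
        inner ℝ (gradStep θ p) (Φ p) +
          softPos (ε n) (profileWeight η θ p) * inner ℝ (gradPos θ p) (Φ p)) ∂surf) atTop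
        (𝓝 (∫ p : S2, inner ℝ (profileGrad η θ p) (Φ p) ∂surf)) := by
      refine tendsto_integral_of_dominated_convergence
        (fun p : S2 => |inner ℝ (gradStep θ p) (Φ p)| +
          (|profileWeight η θ p| + 1) * |inner ℝ (gradPos θ p) (Φ p)|)
        (fun n => ?_) (integrable_of_continuous (by fun_prop)) (fun n => ae_of_all _ fun p => ?_)
        (ae_of_all _ fun p => ?_)
      · have h1 := (contDiff_softPos (hε0 n)).continuous
        have h2 := continuous_softStep (hε0 n)
        exact Continuous.aestronglyMeasurable (by fun_prop)
      · rw [Real.norm_eq_abs]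
        refine (abs_add_le _ _).trans ?_
        rw [abs_mul, abs_mul]
        gcongr
        · exact mul_le_of_le_one_left (abs_nonneg _) (abs_softStep_le _ _)
        · exact abs_softPos_le (hε0 n).le (hε1 n) _
      · have h : inner ℝ (profileGrad η θ p) (Φ p) =
            softStep 0 (profileWeight η θ p) * inner ℝ (gradStep θ p) (Φ p) +
              max (profileWeight η θ p) 0 * inner ℝ (gradPos θ p) (Φ p) := by
          rw [profileGrad, inner_tangential (htan p), inner_add_left, inner_smul_left,
            inner_smul_left]
          simp
        rw [h]
        exact (((tendsto_softStep _).comp hεt).mul_const _).add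
          (((tendsto_softPos _).comp hεt).mul_const _)
    simp_rw [happrox] at hL
    exact tendsto_nhds_unique hL hR.neg

lemma continuous_profileWeight_param (η : ℝ) :
    Continuous fun z : Param × S2 => profileWeight η z.1 z.2 := by
  have h := (contDiff_profileWeight η).continuous.comp
    (continuous_fst.prodMk (continuous_subtype_val.comp continuous_snd) :
      Continuous fun z : Param × S2 => (z.1, (z.2 : E3)))
  exact h

lemma continuous_tangential {A : Param → E3 → E3} (hA : Continuous fun z : Param × E3 => A z.1 z.2) :
    Continuous fun z : Param × S2 => tangential (z.2 : E3) (A z.1 z.2) := by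
  have h : Continuous fun z : Param × S2 => A z.1 (z.2 : E3) := by
    have h := hA.comp (continuous_fst.prodMk (continuous_subtype_val.comp continuous_snd) :
      Continuous fun z : Param × S2 => (z.1, (z.2 : E3)))
    exact h
  unfold tangential
  fun_prop

lemma profileGrad_eq (η : ℝ) (θ : Param) (p : S2) :
    profileGrad η θ p = softStep 0 (profileWeight η θ p) • tangential p (gradStep θ p) +
      max (profileWeight η θ p) 0 • tangential p (gradPos θ p) := by
  rw [profileGrad, tangential_add, tangential_smul, tangential_smul]

lemma measurable_profileGrad (η : ℝ) (θ : Param) : Measurable (profileGrad η θ) := by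
  have hs : Continuous fun p : S2 => (θ, p) := continuous_const.prodMk continuous_id
  have h1 := ((continuous_tangential continuous_gradStep).comp hs).measurable
  have h2 := ((continuous_tangential continuous_gradPos).comp hs).measurable
  have h3 := ((continuous_profileWeight_param η).comp hs).measurable
  have h : profileGrad η θ = fun p => _ := funext (profileGrad_eq η θ)
  rw [h]
  exact (((measurable_softStep 0).comp h3).smul h1).add ((h3.max measurable_const).smul h2)

lemma exists_norm_profileGrad_le (η : ℝ) (θ₀ : Param) :
    ∃ M : ℝ, ∀ θ ∈ Metric.closedBall θ₀ 1, ∀ p, ‖profileGrad η θ p‖ ≤ M := by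
  have hK : IsCompact (Metric.closedBall θ₀ 1 ×ˢ (Set.univ : Set S2)) :=
    (isCompact_closedBall _ _).prod isCompact_univ
  obtain ⟨A, hA⟩ := hK.exists_bound_of_continuousOn
    (continuous_tangential continuous_gradStep).continuousOn
  obtain ⟨B, hB⟩ := hK.exists_bound_of_continuousOn
    (((continuous_profileWeight_param η).max continuous_const).smul
      (continuous_tangential continuous_gradPos)).continuousOn (f := fun z : Param × S2 =>
        max (profileWeight η z.1 z.2) 0 • tangential (z.2 : E3) (gradPos z.1 z.2))
  refine ⟨A + B, fun θ hθ p => ?_⟩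
  rw [profileGrad_eq]
  refine (norm_add_le _ _).trans (add_le_add ?_ (hB (θ, p) ⟨hθ, trivial⟩))
  rw [norm_smul]
  exact (mul_le_of_le_one_left (norm_nonneg _) (abs_softStep_le _ _)).trans
    (hA (θ, p) ⟨hθ, trivial⟩)

lemma continuousAt_profileGrad {η : ℝ} {θ₀ : Param} {p : S2} (h : profileWeight η θ₀ p ≠ 0) :
    ContinuousAt (fun θ => profileGrad η θ p) θ₀ := by
  have hs : Continuous fun θ : Param => (θ, p) := continuous_id.prodMk continuous_const
  have h1 : Continuous fun θ : Param => tangential p (gradStep θ p) :=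
    (continuous_tangential continuous_gradStep).comp hs
  have h2 : Continuous fun θ : Param => tangential p (gradPos θ p) :=
    (continuous_tangential continuous_gradPos).comp hs
  have h3 : Continuous fun θ : Param => profileWeight η θ p :=
    (continuous_profileWeight_param η).comp hs
  have h4 : ContinuousAt (fun θ : Param => softStep 0 (profileWeight η θ p)) θ₀ :=
    ContinuousAt.comp (f := fun θ : Param => profileWeight η θ p)
      (continuousAt_softStep_zero h) h3.continuousAt
  simp only [profileGrad_eq]
  exact (h4.smul h1.continuousAt).add ((h3.max continuous_const).smul h2).continuousAt

/-- Each Gibbs density belongs to every space of the list. -/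
lemma eNorm_profile_lt_top (X : FunctionSpace) (η : ℝ) (θ : Param) :
    X.eNorm (fun p => profile η θ p) < ⊤ := by
  have hc : Continuous fun p : S2 => profile η θ p :=
    (continuous_profile η θ).comp continuous_subtype_val
  obtain ⟨C, hC⟩ := isCompact_univ.exists_bound_of_continuousOn hc.continuousOn
  have hLp (q : ℝ≥0∞) : eLpNorm (fun p : S2 => profile η θ p) q surf < ⊤ :=
    (MemLp.of_bound hc.aestronglyMeasurable C (ae_of_all _ fun p => hC p trivial)).2
  cases X with
  | lebesgue q hq => exact hLp q
  | holder α hα =>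
    obtain ⟨K, hK, -⟩ := exists_lipschitz_profile η θ
    refine (holderNorm_le_of_lipschitz (δ := C.toNNReal) hα (fun p => ?_)
      (hK θ (Metric.mem_closedBall_self zero_le_one))).trans_lt ENNReal.coe_lt_top
    rw [← ofReal_norm]
    exact ENNReal.ofReal_le_ofReal (hC p trivial)
  | sobolev q hq hq' =>
    obtain ⟨M, hM⟩ := exists_norm_profileGrad_le η θ
    refine (sobolevNorm_le (isWeakGradient_profile η θ)).trans_lt
      (ENNReal.add_lt_top.2 ⟨hLp q, ?_⟩)
    exact (MemLp.of_bound (measurable_profileGrad η θ).aestronglyMeasurable M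
      (ae_of_all _ fun p => hM θ (Metric.mem_closedBall_self zero_le_one) p)).2

/-- The gradients of the Gibbs densities depend continuously on the parameter in `L^q` for
`q < ∞`: off the null set where the weight vanishes, the Heaviside function is continuous. -/
lemma tendsto_eLpNorm_profileGrad {q : ℝ≥0∞} (hq : 1 ≤ q) (hq' : q < ⊤) {η : ℝ} {θ₀ : Param}
    (hnull : ∀ᵐ p : S2 ∂surf, profileWeight η θ₀ p ≠ 0) :
    Tendsto (fun θ => eLpNorm (profileGrad η θ - profileGrad η θ₀) q surf) (𝓝 θ₀) (𝓝 0) := by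
  have hq0 : q ≠ 0 := (zero_lt_one.trans_le hq).ne'
  have hqr : 0 < q.toReal := ENNReal.toReal_pos hq0 hq'.ne
  obtain ⟨M, hM⟩ := exists_norm_profileGrad_le η θ₀
  have hlim : Tendsto (fun θ => ∫⁻ p, ‖(profileGrad η θ - profileGrad η θ₀) p‖ₑ ^ q.toReal ∂surf)
      (𝓝 θ₀) (𝓝 (∫⁻ _, 0 ∂surf)) := by
    refine tendsto_lintegral_filter_of_dominated_convergence
      (fun _ => ENNReal.ofReal (M + M) ^ q.toReal) (Eventually.of_forall fun θ => ?_) ?_ ?_ ?_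
    · exact (((measurable_profileGrad η θ).sub (measurable_profileGrad η θ₀)).enorm).pow_const _
    · filter_upwards [Metric.closedBall_mem_nhds θ₀ one_pos] with θ hθ
      refine ae_of_all _ fun p => ENNReal.rpow_le_rpow ?_ hqr.le
      rw [← ofReal_norm]
      refine ENNReal.ofReal_le_ofReal ((norm_sub_le _ _).trans (add_le_add (hM θ hθ p)
        (hM θ₀ (Metric.mem_closedBall_self zero_le_one) p)))
    · rw [lintegral_const]
      exact ENNReal.mul_ne_top (ENNReal.rpow_ne_top_of_nonneg hqr.le ENNReal.ofReal_ne_top)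
        (measure_ne_top _ _)
    · filter_upwards [hnull] with p hp
      have h1 : Tendsto (fun θ => ‖profileGrad η θ p - profileGrad η θ₀ p‖ₑ) (𝓝 θ₀) (𝓝 0) := by
        have := ((continuousAt_profileGrad hp).sub (continuousAt_const (y := profileGrad η θ₀ p))).enorm
        simpa [ContinuousAt] using this
      have h2 := h1.ennrpow_const q.toReal
      rwa [ENNReal.zero_rpow_of_pos hqr] at h2
  simp only [lintegral_zero] at hlim
  have h := hlim.ennrpow_const (1 / q.toReal)
  rw [ENNReal.zero_rpow_of_pos (by positivity)] at h
  simpa only [eLpNorm_eq_lintegral_rpow_enorm_toReal hq0 hq'.ne] using h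

/-- The Gibbs densities depend continuously on the parameter in every space of the list, at each
parameter for which the weight vanishes on a null set only. -/
lemma tendsto_eNorm_profile (X : FunctionSpace) {η : ℝ} {θ₀ : Param}
    (hnull : ∀ᵐ p : S2 ∂surf, profileWeight η θ₀ p ≠ 0) :
    Tendsto (fun θ => X.eNorm ((fun p : S2 => profile η θ p) - fun p : S2 => profile η θ₀ p))
      (𝓝 θ₀) (𝓝 0) := by
  obtain ⟨K, hK, hKd⟩ := exists_lipschitz_profile η θ₀
  have hball := Metric.closedBall_mem_nhds θ₀ one_pos
  have hd : Tendsto (fun θ => K * nndist θ θ₀) (𝓝 θ₀) (𝓝 0) := by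
    have : Continuous fun θ => K * nndist θ θ₀ := by fun_prop
    simpa using this.tendsto θ₀
  have hbd : ∀ᶠ θ in 𝓝 θ₀, ∀ p : S2,
      ‖profile η θ p - profile η θ₀ p‖ₑ ≤ ((K * nndist θ θ₀ : ℝ≥0) : ℝ≥0∞) := by
    filter_upwards [hball] with θ hθ p
    refine (hKd θ hθ p).trans_eq ?_
    rw [edist_nndist, ENNReal.coe_mul]
  have hLp (q : ℝ≥0∞) : Tendsto (fun θ => eLpNorm ((fun p : S2 => profile η θ p) -
      fun p : S2 => profile η θ₀ p) q surf) (𝓝 θ₀) (𝓝 0) := by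
    have hlim : Tendsto (fun θ => surf Set.univ ^ q.toReal⁻¹ *
        ENNReal.ofReal ((K * nndist θ θ₀ : ℝ≥0) : ℝ)) (𝓝 θ₀) (𝓝 0) := by
      have h := ENNReal.Tendsto.const_mul (a := surf Set.univ ^ q.toReal⁻¹)
        (ENNReal.tendsto_coe.2 hd) (Or.inr (ENNReal.rpow_ne_top_of_nonneg
          (inv_nonneg.2 ENNReal.toReal_nonneg) (measure_ne_top _ _)))
      simpa only [ENNReal.ofReal_coe_nnreal, ENNReal.coe_zero, mul_zero] using h
    refine tendsto_of_tendsto_of_tendsto_of_le_of_le' tendsto_const_nhds hlim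
      (Eventually.of_forall fun _ => zero_le) ?_
    filter_upwards [hbd] with θ hθ
    refine eLpNorm_le_of_ae_bound (ae_of_all _ fun p => ?_)
    have := hθ p
    rw [enorm_le_coe] at this
    exact this
  cases X with
  | lebesgue q hq => exact hLp q
  | holder α hα =>
    have hα' : (0 : ℝ) < 1 - α := sub_pos.2 (by exact_mod_cast hα)
    have hlim : Tendsto (fun θ => ((K * nndist θ θ₀ + (2 * (K * nndist θ θ₀)) ^ (1 - α : ℝ) *
        (K + K) ^ (α : ℝ) : ℝ≥0) : ℝ≥0∞)) (𝓝 θ₀) (𝓝 0) := by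
      rw [← ENNReal.coe_zero, ENNReal.tendsto_coe]
      have h1 := ((hd.const_mul 2).nnrpow (tendsto_const_nhds (x := (1 - α : ℝ)))
        (Or.inr hα')).mul_const ((K + K) ^ (α : ℝ))
      have h2 := hd.add h1
      rwa [mul_zero, NNReal.zero_rpow hα'.ne', zero_mul, add_zero] at h2
    refine tendsto_of_tendsto_of_tendsto_of_le_of_le' tendsto_const_nhds hlim
      (Eventually.of_forall fun _ => zero_le) ?_
    filter_upwards [hbd, hball] with θ hθ hθb
    exact holderNorm_le_of_lipschitz hα hθ
      ((hK θ hθb).sub (hK θ₀ (Metric.mem_closedBall_self zero_le_one)))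
  | sobolev q hq hq' =>
    have hlim := (hLp q).add (tendsto_eLpNorm_profileGrad hq hq' hnull)
    rw [add_zero] at hlim
    exact tendsto_of_tendsto_of_tendsto_of_le_of_le tendsto_const_nhds hlim
      (fun _ => zero_le) fun θ =>
        sobolevNorm_le ((isWeakGradient_profile η θ).sub (isWeakGradient_profile η θ₀))

/-! ### Local minimisers of the energy on the sphere -/

/-- The parameter of the fibre minimiser. -/
def fibreParam (η : ℝ) (b : QSpace) : Param :=
  (b, multiplier η b,
    -inner ℝ (multiplier η b) b - Real.log (partition η b (multiplier η b)))

lemma profileWeight_fibreParam (η : ℝ) (b : QSpace) (p : S2) :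
    profileWeight η (fibreParam η b) p = weight η b p := by
  unfold profileWeight weight fibreParam
  rfl

lemma fibreMin_eq_profile {η : ℝ} {b : QSpace} (hb : b ∈ feasible η) (p : S2) :
    fibreMin η b p = profile η (fibreParam η b) p := by
  have hJ := partition_pos hb (multiplier η b)
  have h : profileExp (fibreParam η b) p =
      Real.exp (inner ℝ (multiplier η b) (qt p - b)) / partition η b (multiplier η b) := by
    have h1 : profileExp (fibreParam η b) p = Real.exp (inner ℝ (multiplier η b) (qt p) +
        (-inner ℝ (multiplier η b) b - Real.log (partition η b (multiplier η b)))) := by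
      unfold profileExp fibreParam
      rfl
    rw [h1, inner_sub_right, ← add_sub_assoc, ← sub_eq_add_neg, Real.exp_sub, Real.exp_log hJ]
  rw [fibreMin, gibbsWeight, profile, profileWeight_fibreParam, h, mul_div_assoc]

lemma continuousOn_fibreParam (η : ℝ) : ContinuousOn (fibreParam η) (feasible η) := by
  have h1 := continuousOn_multiplier η
  have hid : ContinuousOn (fun b : QSpace => b) (feasible η) := continuousOn_id
  have h2 := (continuous_partition η).comp_continuousOn (hid.prodMk h1)
  have h3 := h2.log fun b hb => (partition_pos hb (multiplier η b)).ne'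
  have h4 : ContinuousOn (fun b : QSpace => (b : E9)) (feasible η) :=
    continuous_subtype_val.continuousOn
  have h5 : ContinuousOn (fun b => (multiplier η b : E9)) (feasible η) :=
    continuous_subtype_val.comp_continuousOn h1
  have h6 : ContinuousOn (fun b => inner ℝ (multiplier η b) b) (feasible η) := h1.inner hid
  unfold fibreParam
  exact h4.prodMk (h5.prodMk (h6.neg.sub h3))

lemma ae_weight_ne_zero {η : ℝ} {b : QSpace} (hb : b ∈ feasible η) :
    ∀ᵐ p ∂surf, weight η b p ≠ 0 := by
  rcases eq_or_ne b 0 with rfl | hb0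
  · obtain ⟨g, hg, hfin, hm⟩ := hb
    obtain ⟨p, hp, -⟩ := hg.exists_of_ae hfin (P := fun _ => True) (by simp)
    rw [hm] at hp
    refine ae_of_all _ fun q => ?_
    simp only [weight, inner_zero_left] at hp ⊢
    exact hp.ne'
  · rw [ae_iff]
    simpa [weight, sub_eq_zero] using surf_level_qt hb0 η

lemma eNorm_fibreMin_lt_top (X : FunctionSpace) {η : ℝ} {b : QSpace} (hb : b ∈ feasible η) :
    X.eNorm (fibreMin η b) < ⊤ := by
  rw [funext (fibreMin_eq_profile hb)]
  exact eNorm_profile_lt_top X η _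

/-- The fibre minimiser depends continuously on the Q-tensor, in every space of the list. -/
lemma tendsto_eNorm_fibreMin (X : FunctionSpace) {η : ℝ} {b₀ : QSpace} (hb₀ : b₀ ∈ feasible η) :
    Tendsto (fun b => X.eNorm (fibreMin η b - fibreMin η b₀)) (𝓝[feasible η] b₀) (𝓝 0) := by
  have hnull : ∀ᵐ p : S2 ∂surf, profileWeight η (fibreParam η b₀) p ≠ 0 := by
    simpa only [profileWeight_fibreParam] using ae_weight_ne_zero hb₀
  refine ((tendsto_eNorm_profile X hnull).comp (continuousOn_fibreParam η b₀ hb₀)).congr' ?_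
  filter_upwards [self_mem_nhdsWithin] with b hb
  rw [Function.comp, funext (fibreMin_eq_profile hb), funext (fibreMin_eq_profile hb₀)]

/-- The moment map is continuous with respect to the norm of every space of the list. -/
lemma exists_dist_moment_lt (X : FunctionSpace) {f : S2 → ℝ} (hf : Integrable f surf) {δ : ℝ}
    (hδ : 0 < δ) : ∃ ε : ℝ≥0∞, 0 < ε ∧ ∀ g, Integrable g surf → X.eNorm (g - f) < ε →
      dist (moment g) (moment f) < δ := by
  obtain ⟨C, hC, hle⟩ := X.exists_eLpNorm_one_le
  refine ⟨ENNReal.ofReal δ / (C + 1), ENNReal.div_pos (by simpa using hδ)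
    (ENNReal.add_ne_top.2 ⟨hC, by simp⟩), fun g hg hlt => ?_⟩
  have h1 : ‖moment g - moment f‖ₑ < ENNReal.ofReal δ := by
    calc ‖moment g - moment f‖ₑ ≤ X.eNorm (g - f) * C :=
          (enorm_moment_sub_le hf hg).trans (hle _ (hg.sub hf).aestronglyMeasurable)
      _ ≤ X.eNorm (g - f) * (C + 1) := mul_le_mul_right le_self_add _
      _ < ENNReal.ofReal δ := (ENNReal.lt_div_iff_mul_lt (by simp)
          (Or.inl (ENNReal.add_ne_top.2 ⟨hC, by simp⟩))).1 hlt
  rw [← ofReal_norm, ENNReal.ofReal_lt_ofReal_iff hδ] at h1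
  rwa [dist_eq_norm]

lemma exists_energy_eq {η : ℝ} {f : S2 → ℝ} (hf : IsDensity f) (hfin : energy η f < ⊤) :
    ∃ a : ℝ, energy η f = a :=
  ⟨_, energy_eq_integral hf (of_energy_lt_top hf hfin).1 (of_energy_lt_top hf hfin).2⟩

lemma energy_fibreMin_le {η : ℝ} {g : S2 → ℝ} (hg : IsDensity g) (hfin : energy η g < ⊤) :
    energy η (fibreMin η (moment g)) ≤ energy η g := by
  rw [energy_fibreMin ⟨g, hg, hfin, rfl⟩]
  exact (gibbs_principle hg hfin).1

/-- The characterisation that makes local minimality independent of the space: a local minimiser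
is a fibre minimiser whose Q-tensor is a local minimiser of the energy of the fibre minimisers. -/
lemma isLocalMinimiser_iff (X : FunctionSpace) (η : ℝ) (f : S2 → ℝ) :
    IsLocalMinimiser X η f ↔ IsDensity f ∧ energy η f < ⊤ ∧ f =ᵐ[surf] fibreMin η (moment f) ∧
      ∀ᶠ b in 𝓝[feasible η] (moment f), energy η f ≤ energy η (fibreMin η b) := by
  constructor
  · rintro ⟨hf, hXf, hfin, ε, hε, hmin⟩
    have hb : moment f ∈ feasible η := ⟨f, hf, hfin, rfl⟩
    have hs := isDensity_fibreMin hb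
    have heq : f =ᵐ[surf] fibreMin η (moment f) := by
      by_contra hne
      obtain ⟨a, ha⟩ := exists_energy_eq hf hfin
      have hc := energy_fibreMin hb
      obtain ⟨hle, hrig⟩ := gibbs_principle hf hfin
      set c := -Real.log (partition η (moment f) (multiplier η (moment f)))
      have hca : c < a := by
        rw [ha, EReal.coe_le_coe_iff] at hle
        refine lt_of_le_of_ne hle fun h => hne (hrig ?_)
        rw [ha, h]
      obtain ⟨C, hC, hCle⟩ := X.exists_eNorm_smul_sub_le hf.1 hs.1 hXf
        (eNorm_fibreMin_lt_top X hb)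
      have hlim : Tendsto (fun t : ℝ => ‖t‖ₑ * C) (𝓝 0) (𝓝 0) := by
        have h := ENNReal.Tendsto.mul_const (b := C)
          ((continuous_enorm (E := ℝ)).tendsto 0) (Or.inr hC)
        simpa using h
      obtain ⟨t, ht, ht1, ht0⟩ := ((eventually_nhdsWithin_of_eventually_nhds
        (hlim.eventually (gt_mem_nhds hε))).and ((eventually_nhdsWithin_of_eventually_nhds
          (gt_mem_nhds one_pos)).and (self_mem_nhdsWithin (s := Set.Ioi (0 : ℝ))))).exists
      obtain ⟨hd, hseg⟩ := energy_segment_le hf hs (moment_fibreMin hb).symm ha hc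
        (le_of_lt ht0) ht1.le
      have h := (hmin _ hd (by
        rw [add_sub_cancel_left]
        exact (hCle t).trans_lt ht)).trans hseg
      rw [ha, EReal.coe_le_coe_iff] at h
      have ht0' : 0 < t := ht0
      nlinarith
    refine ⟨hf, hfin, heq, ?_⟩
    filter_upwards [(tendsto_eNorm_fibreMin X hb).eventually (gt_mem_nhds hε),
      self_mem_nhdsWithin] with b hlt hbD
    refine hmin _ (isDensity_fibreMin hbD) ?_
    rwa [X.eNorm_congr (heq.mono fun p hp => by
      rw [Pi.sub_apply, Pi.sub_apply, hp] :
        fibreMin η b - f =ᵐ[surf] fibreMin η b - fibreMin η (moment f))]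
  · rintro ⟨hf, hfin, heq, hev⟩
    have hb : moment f ∈ feasible η := ⟨f, hf, hfin, rfl⟩
    refine ⟨hf, ?_, hfin, ?_⟩
    · rw [X.eNorm_congr heq]
      exact eNorm_fibreMin_lt_top X hb
    · obtain ⟨δ, hδ, hball⟩ := Metric.eventually_nhds_iff.1 (eventually_nhdsWithin_iff.1 hev)
      obtain ⟨ε, hε, hlt⟩ := exists_dist_moment_lt X hf.1 hδ
      refine ⟨ε, hε, fun g hg hgε => ?_⟩
      rcases eq_top_or_lt_top (energy η g) with htop | hgfin
      · rw [htop]; exact le_top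
      · exact (hball (hlt g hg.1 hgε) ⟨g, hg, hgfin, rfl⟩).trans (energy_fibreMin_le hg hgfin)

end SphereEnergy

end

theorem mainTheorem3 :
    (∀ (k : ℕ) (V : Type*) [NormedAddCommGroup V] [NormedSpace ℝ V] [CompleteSpace V]
      (U : Set V) (T : V →L[ℝ] EuclideanSpace ℝ (Fin k)) (F : V → EReal)
      (X : Type*) [NormedAddCommGroup X] [NormedSpace ℝ X] [CompleteSpace X] (ιX : X →L[ℝ] V)
      (Y : Type*) [NormedAddCommGroup Y] [NormedSpace ℝ Y] [CompleteSpace Y] (ιY : Y →L[ℝ] V),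
      FibreProblem.IsAdmissible U T F →
      FibreProblem.IsAdmissibleSpace U T F ιX → FibreProblem.IsAdmissibleSpace U T F ιY →
      ∀ f : V, FibreProblem.IsLocalMinimiser U F ιX f ↔ FibreProblem.IsLocalMinimiser U F ιY f) ∧
    (∀ (η : ℝ) (f : SphereEnergy.S2 → ℝ),
      (∀ (q : ENNReal) (hq : 1 ≤ q) (hq_top : q < ⊤),
        SphereEnergy.IsLocalMinimiser (.sobolev q hq hq_top) η f →
          SphereEnergy.IsLocalMinimiser (.lebesgue 1 le_rfl) η f) ∧
      ∀ X Y : SphereEnergy.FunctionSpace,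
        SphereEnergy.IsLocalMinimiser X η f ↔ SphereEnergy.IsLocalMinimiser Y η f) := by
  refine ⟨?_, fun η f => ⟨?_, ?_⟩⟩
  · intro k V _ _ _ U T F X _ _ _ ιX Y _ _ _ ιY hF hX hY f
    rw [FibreProblem.isLocalMinimiser_iff hF hX, FibreProblem.isLocalMinimiser_iff hF hY]
  · intro q hq hq_top h
    rw [SphereEnergy.isLocalMinimiser_iff] at h ⊢
    exact h
  · intro X Y
    rw [SphereEnergy.isLocalMinimiser_iff, SphereEnergy.isLocalMinimiser_iff]
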